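/- **Setting.** Let $d\ge 1$, $D,B,P,\sigma>0$ and $\mathrm{SNR}=P/\sigma^2$; $\log$ is to base $2$. Let $\mathcal X\subset\mathbb R^d$ be a nonempty convex set of diameter at most $D$. Let $\mathcal O$ be the set of pairs $(f,O)$ where $f:\mathcal X\to\mathbb R$ is convex and $O$ is an oracle which, when queried at $x\in\mathcal X$, returns (with fresh randomness) a random vector $\hat g(x)\in\mathbb R^d$ with $\mathbb E[\hat g(x)]\in\partial f(x)$ and $\mathbb E\|\hat g(x)\|^2\le B^2$. A code of length $\ell\ge 1$ is a (randomized) encoder $\varphi(\cdot,U):\mathbb R^d\to\mathbb R^\ell$ such that $\mathbb E\|\varphi(\hat g,U)\|^2\le \ell P$ for every random vector $\hat g$ independent of $U$ with $\mathbb E\|\hat g\|^2\le B^2$. The public randomness $U$ is drawn afresh at each use and is revealed to the optimization algorithm. The code is *analog* if $\ell\le d$ and $\varphi(g,U)=\mathbf A(U)g$ for a (random) $\ell\times d$ matrix $\mathbf A(U)$. The *scaled transmission* code is the analog code $\varphi(g)=\frac{\sqrt{Pd}}{B}\,g$ of length $\ell=d$. A (possibly randomized) algorithm $\pi$ makes $T$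 queries. In iteration $t$ it chooses $x_t\in\mathcal X$ from its past observations, the oracle produces $\hat g_t=\hat g(x_t)$, and $\pi$ observes $U_t$ and $Y_t=\varphi(\hat g_t,U_t)+Z_t$, with independent noise $Z_t\sim\mathcal N(0,\sigma^2 I_\ell)$. From all observations it finally outputs a point $\hat x\in\mathcal X$. Its error is $\mathcal E(f,\pi^{\varphi O})=\mathbb E f(\hat x)-\inf_{\mathcal X}f$. For a class $\mathcal C$ of codes put $$\mathcal E^*_{\mathcal C}(N)=\sup_{\mathcal X}\ \inf_{(\pi,\varphi):\ \varphi\in\mathcal C,\ \ell T\le N}\ \sup_{(f,O)\in\mathcal O}\mathcal E(f,\pi^{\varphi O}),$$ and write $\mathcal E^*$, $\mathcal E^*_{analog}$, $\mathcal E^*_{scaled}$ for this quantity when $\mathcal C$ consists of all codes, of the analog codes, and of the scaled transmission code only. **Statement.** There are universal constants $c_1,c_2>0$ such that whenever $\mathrm{SNR}\in(0,1)$ and $N\in\mathbb N$ satisfies $N\ge \frac{d}{\log(1+\mathrm{SNR})}$, $$\frac{c_1DB}{\sqrt N}\sqrt{\frac{d}{\log(1+\mathrm{SNR})}}\ \le\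 \mathcal E^*_{analog}(N)\ \le\ \frac{c_2DB}{\sqrt N}\sqrt{\frac{d}{\log(1+\mathrm{SNR})}} .$$ Moreover analog codes, and specifically scaled transmission, are optimal up to constant factors among all codes: $$\frac{c_1DB}{\sqrt N}\sqrt{\frac{d}{\log(1+\mathrm{SNR})}}\ \le\ \mathcal E^*(N)\qquad\text{and}\qquad \mathcal E^*_{scaled}(N)\ \le\ \frac{c_2DB}{\sqrt N}\sqrt{\frac{d}{\log(1+\mathrm{SNR})}} .$$ -/

import Mathlib

open MeasureTheory ProbabilityTheory
open scoped ENNReal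

namespace OverTheAir

noncomputable section

/-- Euclidean space `ℝⁿ`. -/
abbrev Euc (n : ℕ) : Type := EuclideanSpace ℝ (Fin n)

/-- The admissible domains: nonempty convex sets of diameter at most `D`. -/
def domains (d : ℕ) (D : ℝ) : Set (Set (Euc d)) :=
  {X | X.Nonempty ∧ Convex ℝ X ∧ ∀ x ∈ X, ∀ y ∈ X, ‖x - y‖ ≤ D}

/-- The set of subgradients at `x` of a function `f` on the domain `X`
(the values of `f` outside `X` play no role). -/
def subdifferential {d : ℕ} (X : Set (Euc d)) (f : Euc d → ℝ) (x : Euc d) : Set (Euc d) :=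
  {g | ∀ y ∈ X, f x + inner ℝ g (y - x) ≤ f y}

/-- A pair `(f, O)` of a convex function on `X` and a noisy first-order oracle for it: `O x` is the
law of the subgradient estimate returned when `x` is queried, with fresh randomness at each query.
The estimate is unbiased and has second moment at most `B²`. -/
structure Instance {d : ℕ} (X : Set (Euc d)) (B : ℝ) where
  f : Euc d → ℝ
  convex : ConvexOn ℝ X f
  O : Kernel X (Euc d)
  markov : IsMarkovKernel O
  unbiased : ∀ x : X, (∫ g, g ∂(O x)) ∈ subdifferential X f x
  meanSquare : ∀ x : X, ∫⁻ g, ‖g‖ₑ ^ 2 ∂(O x) ≤ ENNReal.ofReal (B ^ 2)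

/-- A code of length `ℓ` and average power at most `P` for estimates in `ℝᵈ` of second moment at
most `B²`. The encoder is randomized by public randomness with law `lawU`, drawn independently of
the estimate that is encoded. -/
structure Code (d ℓ : ℕ) (B P : ℝ) where
  U : Type
  mU : MeasurableSpace U
  lawU : Measure U
  probU : IsProbabilityMeasure lawU
  enc : Euc d → U → Euc ℓ
  measurable_enc : Measurable (Function.uncurry enc)
  power : ∀ ν : Measure (Euc d), IsProbabilityMeasure ν →
    ∫⁻ g, ‖g‖ₑ ^ 2 ∂ν ≤ ENNReal.ofReal (B ^ 2) →
    ∫⁻ g, ∫⁻ u, ‖enc g u‖ₑ ^ 2 ∂lawU ∂ν ≤ ENNReal.ofReal (ℓ * P)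

attribute [instance] Code.mU Code.probU Instance.markov

/-- The law of the channel noise: `ℓ` independent `N(0, σ²)` coordinates. -/
def noise (ℓ : ℕ) (σ : ℝ) : Measure (Euc ℓ) :=
  (Measure.pi fun _ : Fin ℓ => gaussianReal 0 (σ ^ 2).toNNReal).map (WithLp.toLp 2)

/-- What the algorithm gets to see in one iteration: the public randomness and the channel
output. -/
abbrev Obs {d ℓ : ℕ} {B P : ℝ} (c : Code d ℓ B P) : Type := c.U × Euc ℓ

/-- A (possibly randomized) optimization algorithm on `X` using the code `c`. The query number `t`
(counted from `0`) depends on the private seed and on the `t` observations made so far; the output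
after `T` queries depends on the seed and all `T` observations. -/
structure Algorithm {d ℓ : ℕ} {B P : ℝ} (X : Set (Euc d)) (c : Code d ℓ B P) (T : ℕ) where
  W : Type
  mW : MeasurableSpace W
  lawW : Measure W
  probW : IsProbabilityMeasure lawW
  query : (t : ℕ) → W × (Fin t → Obs c) → X
  measurable_query : ∀ t, Measurable (query t)
  output : W × (Fin T → Obs c) → X
  measurable_output : Measurable output

attribute [instance] Algorithm.mW Algorithm.probW

section Run

variable {d ℓ T : ℕ} {B P : ℝ} {X : Set (Euc d)} {c : Code d ℓ B P}

/-- The law of the observation `(U, φ(ĝ, U) + Z)` after the query `x`, where `ĝ ∼ O x`, the public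
randomness `U` and the noise `Z` are independent. -/
def observe (c : Code d ℓ B P) (σ : ℝ) (O : Kernel X (Euc d)) : Kernel X (Obs c) :=
  (O ×ₖ Kernel.const X (c.lawU.prod (noise ℓ σ))).map
    fun p => (p.2.1, c.enc p.1 p.2.1 + p.2.2)

/-- The joint law of the seed and the first `t` observations when the algorithm is run with the
oracle `O` over the Gaussian channel. -/
def transcript (σ : ℝ) (π : Algorithm X c T) (O : Kernel X (Euc d)) :
    (t : ℕ) → Measure (π.W × (Fin t → Obs c))
  | 0 => π.lawW.map fun w => (w, Fin.elim0)
  | t + 1 =>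
    (transcript σ π O t ⊗ₘ (observe c σ O).comap (π.query t) (π.measurable_query t)).map
      fun q => (q.1.1, Fin.snoc (α := fun _ => Obs c) q.1.2 q.2)

/-- The convergence error: expected value of `f` at the output, minus the infimum of `f` on `X`. -/
def convError (σ : ℝ) (π : Algorithm X c T) (I : Instance X B) : ℝ :=
  (∫ h, I.f (π.output h) ∂(transcript σ π I.O T)) - ⨅ x : X, I.f x

/-- The worst-case convergence error of a protocol over all functions and oracles. -/
def worstError (σ : ℝ) (π : Algorithm X c T) : EReal :=
  ⨆ I : Instance X B, (convError σ π I : EReal)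

end Run

/-- A class of codes, of arbitrary lengths. -/
abbrev CodeClass (d : ℕ) (B P : ℝ) : Type 1 := (ℓ : ℕ) → Set (Code d ℓ B P)

/-- The smallest worst-case error on `X` with at most `N` channel uses and codes from `C`. -/
def minimaxErrorOn {d : ℕ} {B P : ℝ} (C : CodeClass d B P) (σ : ℝ) (N : ℕ)
    (X : Set (Euc d)) : EReal :=
  ⨅ (ℓ : ℕ) (_ : 1 ≤ ℓ) (T : ℕ) (_ : ℓ * T ≤ N) (c : Code d ℓ B P) (_ : c ∈ C ℓ)
    (π : Algorithm X c T), worstError σ π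

/-- The min-max error with at most `N` channel uses and codes from `C`: the supremum over all
admissible domains of the smallest worst-case error. -/
def minimaxError {d : ℕ} {B P : ℝ} (C : CodeClass d B P) (D σ : ℝ) (N : ℕ) : EReal :=
  ⨆ X ∈ domains d D, minimaxErrorOn C σ N X

/-- All codes. -/
def allCodes (d : ℕ) (B P : ℝ) : CodeClass d B P := fun _ => Set.univ

/-- Analog codes: length `ℓ ≤ d`, and `φ(g, U) = A(U) g` for a (random) `ℓ × d` matrix `A(U)`. -/
def analogCodes (d : ℕ) (B P : ℝ) : CodeClass d B P := fun ℓ =>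
  {c | ℓ ≤ d ∧ ∃ A : c.U → Matrix (Fin ℓ) (Fin d) ℝ,
    ∀ g u i, c.enc g u i = ∑ j, A u i j * g j}

/-- The scaled transmission code: length `d`, and `φ(g) = (√(Pd) / B) g`. -/
def scaledTransmission (d : ℕ) (B P : ℝ) : CodeClass d B P := fun ℓ =>
  {c | ∃ h : ℓ = d, ∀ g u i, c.enc g u i = √(P * d) / B * g (Fin.cast h i)}

end

end OverTheAir

/-!
Upper bound. With scaled transmission, rescaling the channel output gives an unbiased subgradient
estimate of second moment at most `B² (1 + σ² / P)`. Projected stochastic gradient descent with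
`N / d` such estimates has error `O(D B √(d (1 + σ² / P) / N))`, and `1 + σ² / P` is of the order of
`1 / log(1 + SNR)` when `SNR < 1`.

Lower bound (Assouad's method). On a cube, hide a sign vector `v` in the linear functions with
slope `δ B v / √d`; at every query the oracle returns `B s / √d`, where the signs `s` are
independent and agree with `v` with probability `(1 + δ) / 2`. Reversing `v i` multiplies the law
of `s` by a density `1 + X i`, hence by Bayes' rule the law of a channel observation by
`1 + 𝔼[X i | observation]`, so the two observation laws are at `χ²`-divergence
`𝔼[𝔼[X i | observation]²]`.
The `X i` are independent, centred and bounded by `4 δ`, hence sub-Gaussian, and the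
Donsker–Varadhan inequality bounds the sum over `i` of `𝔼[X i | observation]²` by a multiple of
`δ²` times the divergence of the posterior law of `s` from its prior. The mean of that divergence
is the mutual information, which the power constraint bounds by `ℓ SNR / 2` whatever the code. So
with `δ² ∼ d / (N log(1 + SNR))` a constant fraction of the signs cannot be identified from the
observations.
-/

namespace OverTheAir

noncomputable section

section SecondMoment

variable {Ω E : Type*} [MeasurableSpace Ω] {μ : Measure Ω} [NormedAddCommGroup E]
  {f : Ω → E} {C : ℝ}

lemma memLp_two_of_lintegral_enorm_sq_le (hf : AEStronglyMeasurable f μ)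
    (hC : ∫⁻ ω, ‖f ω‖ₑ ^ 2 ∂μ ≤ ENNReal.ofReal C) : MemLp f 2 μ := by
  refine (memLp_two_iff_integrable_sq_norm hf).2 ⟨hf.norm.pow 2, ?_⟩
  simpa [hasFiniteIntegral_iff_enorm] using hC.trans_lt ENNReal.ofReal_lt_top

lemma integral_norm_sq_le_of_lintegral_enorm_sq_le (hf : AEStronglyMeasurable f μ) (hC0 : 0 ≤ C)
    (hC : ∫⁻ ω, ‖f ω‖ₑ ^ 2 ∂μ ≤ ENNReal.ofReal C) : ∫ ω, ‖f ω‖ ^ 2 ∂μ ≤ C := by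
  rw [integral_eq_lintegral_of_nonneg_ae (ae_of_all _ fun _ => sq_nonneg _) (hf.norm.pow 2)]
  refine ENNReal.toReal_le_of_le_ofReal hC0 ((lintegral_congr fun ω => ?_).trans_le hC)
  rw [ENNReal.ofReal_pow (norm_nonneg _), ofReal_norm]

end SecondMoment

section Noise

variable (ℓ : ℕ) (σ : ℝ)

lemma noise_eq_map_stdGaussian :
    noise ℓ σ = (stdGaussian (Euc ℓ)).map (fun z => σ • z) := by
  have hscale : (gaussianReal 0 1).map (fun x => σ * x) = gaussianReal 0 (σ ^ 2).toNNReal := by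
    rw [gaussianReal_map_const_mul, mul_zero, mul_one]
    congr 1
    ext
    simp [sq_nonneg]
  have hpi : (Measure.pi fun _ : Fin ℓ => gaussianReal 0 (σ ^ 2).toNNReal) =
      (Measure.pi fun _ : Fin ℓ => gaussianReal 0 1).map fun x i => σ * x i := by
    have (_ : Fin ℓ) : SigmaFinite ((gaussianReal 0 1).map fun x => σ * x) := by
      rw [hscale]; infer_instance
    rw [Measure.pi_map_pi (fun _ => by fun_prop), hscale]
  rw [noise, hpi, ← map_pi_eq_stdGaussian, Measure.map_map (by fun_prop) (by fun_prop),
    Measure.map_map (by fun_prop) (by fun_prop)]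
  rfl

instance isGaussian_noise : IsGaussian (noise ℓ σ) := by
  rw [noise_eq_map_stdGaussian]
  exact isGaussian_map (σ • ContinuousLinearMap.id ℝ (Euc ℓ))

lemma integral_id_noise : ∫ z, z ∂(noise ℓ σ) = 0 := by
  rw [noise_eq_map_stdGaussian, integral_map (by fun_prop) (by fun_prop), integral_smul,
    integral_id_stdGaussian, smul_zero]

lemma memLp_two_noise : MemLp (fun z : Euc ℓ => z) 2 (noise ℓ σ) :=
  IsGaussian.memLp_two_id

lemma integral_sq_coord_noise (i : Fin ℓ) : ∫ z, z i ^ 2 ∂(noise ℓ σ) = σ ^ 2 := by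
  rw [noise, integral_map (by fun_prop) (by fun_prop),
    integral_comp_eval (μ := fun _ : Fin ℓ => gaussianReal 0 (σ ^ 2).toNNReal) (i := i)
      (f := fun x => x ^ 2) (by fun_prop)]
  have h := variance_fun_id_gaussianReal (μ := 0) (v := (σ ^ 2).toNNReal)
  rwa [variance_of_integral_eq_zero (by fun_prop) (by simp),
    Real.coe_toNNReal _ (sq_nonneg σ)] at h

lemma integral_norm_sq_noise : ∫ z, ‖z‖ ^ 2 ∂(noise ℓ σ) = ℓ * σ ^ 2 := by
  have hint (i : Fin ℓ) : Integrable (fun z : Euc ℓ => z i ^ 2) (noise ℓ σ) :=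
    ((memLp_two_noise ℓ σ).eval_piLp i).integrable_sq
  simp_rw [EuclideanSpace.real_norm_sq_eq]
  rw [integral_finsetSum _ fun i _ => hint i]
  simp [integral_sq_coord_noise]

end Noise

section Transcript

variable {d ℓ T : ℕ} {B P σ : ℝ} {X : Set (Euc d)} {c : Code d ℓ B P}

lemma measurable_channelOutput (c : Code d ℓ B P) :
    Measurable fun p : Euc d × c.U × Euc ℓ => (p.2.1, c.enc p.1 p.2.1 + p.2.2) := by
  have h : Measurable fun p : Euc d × c.U × Euc ℓ => c.enc p.1 p.2.1 :=
    c.measurable_enc.comp (measurable_fst.prodMk (measurable_fst.comp measurable_snd))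
  fun_prop

lemma observe_apply (c : Code d ℓ B P) (σ : ℝ) (O : Kernel X (Euc d)) [IsMarkovKernel O] (x : X) :
    observe c σ O x = ((O x).prod (c.lawU.prod (noise ℓ σ))).map
      fun p => (p.2.1, c.enc p.1 p.2.1 + p.2.2) := by
  rw [observe, Kernel.map_apply _ (measurable_channelOutput c), Kernel.prod_apply,
    Kernel.const_apply]

instance isMarkovKernel_observe (c : Code d ℓ B P) (σ : ℝ) (O : Kernel X (Euc d))
    [IsMarkovKernel O] : IsMarkovKernel (observe c σ O) :=
  Kernel.IsMarkovKernel.map _ (measurable_channelOutput c)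

lemma measurable_snoc {W Ω : Type*} [MeasurableSpace W] [MeasurableSpace Ω] {t : ℕ} :
    Measurable fun q : (W × (Fin t → Ω)) × Ω =>
      (q.1.1, Fin.snoc (α := fun _ => Ω) q.1.2 q.2) := by
  refine (measurable_fst.comp measurable_fst).prodMk (measurable_pi_iff.2 fun i => ?_)
  refine Fin.lastCases ?_ (fun j => ?_) i
  · simpa only [Fin.snoc_last] using measurable_snd
  · simp only [Fin.snoc_castSucc]
    fun_prop

instance isProbabilityMeasure_transcript (σ : ℝ) (π : Algorithm X c T) (O : Kernel X (Euc d))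
    [IsMarkovKernel O] : ∀ t, IsProbabilityMeasure (transcript σ π O t)
  | 0 => Measure.isProbabilityMeasure_map (by fun_prop)
  | t + 1 => by
    have := isProbabilityMeasure_transcript σ π O t
    exact Measure.isProbabilityMeasure_map measurable_snoc.aemeasurable

lemma lintegral_transcript_succ (π : Algorithm X c T) (O : Kernel X (Euc d)) [IsMarkovKernel O]
    (t : ℕ) {F : π.W × (Fin (t + 1) → Obs c) → ℝ≥0∞} (hF : Measurable F) :
    ∫⁻ h, F h ∂(transcript σ π O (t + 1)) =
      ∫⁻ q, ∫⁻ o, F (q.1, Fin.snoc (α := fun _ => Obs c) q.2 o) ∂(observe c σ O (π.query t q))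
        ∂(transcript σ π O t) := by
  rw [transcript, lintegral_map hF measurable_snoc]
  exact Measure.lintegral_compProd (hF.comp measurable_snoc)

lemma integral_transcript_le_of_drift (π : Algorithm X c T) (O : Kernel X (Euc d))
    [IsMarkovKernel O] {Φ : (t : ℕ) → π.W × (Fin t → Obs c) → ℝ} {C : ℝ}
    (hmeas : ∀ t, Measurable (Φ t)) (hbdd : ∀ t, ∃ K, ∀ h, |Φ t h| ≤ K)
    (hdrift : ∀ t q, ∫ o, Φ (t + 1) (q.1, Fin.snoc (α := fun _ => Obs c) q.2 o)
      ∂(observe c σ O (π.query t q)) ≤ Φ t q + C) (t : ℕ) :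
    ∫ h, Φ t h ∂(transcript σ π O t) ≤ ∫ h, Φ 0 h ∂(transcript σ π O 0) + t * C := by
  induction t with
  | zero => simp
  | succ t ih =>
    obtain ⟨K, hK⟩ := hbdd t
    obtain ⟨K', hK'⟩ := hbdd (t + 1)
    have hint : Integrable (fun q : (π.W × (Fin t → Obs c)) × Obs c =>
        Φ (t + 1) (q.1.1, Fin.snoc (α := fun _ => Obs c) q.1.2 q.2))
        (transcript σ π O t ⊗ₘ (observe c σ O).comap (π.query t) (π.measurable_query t)) :=
      .of_bound ((hmeas _).comp measurable_snoc).aestronglyMeasurable K'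
        (ae_of_all _ fun _ => hK' _)
    have hintΦ : Integrable (Φ t) (transcript σ π O t) :=
      .of_bound (hmeas t).aestronglyMeasurable K (ae_of_all _ hK)
    calc ∫ h, Φ (t + 1) h ∂(transcript σ π O (t + 1))
        = ∫ q, ∫ o, Φ (t + 1) (q.1, Fin.snoc (α := fun _ => Obs c) q.2 o)
            ∂(observe c σ O (π.query t q)) ∂(transcript σ π O t) := by
          rw [transcript, integral_map measurable_snoc.aemeasurable
            (hmeas _).aestronglyMeasurable, Measure.integral_compProd hint]
          rfl
      _ ≤ ∫ q, (Φ t q + C) ∂(transcript σ π O t) :=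
          integral_mono hint.integral_compProd (hintΦ.add (integrable_const C)) (hdrift t)
      _ = ∫ q, Φ t q ∂(transcript σ π O t) + C := by
          simp [integral_add hintΦ (integrable_const C)]
      _ ≤ ∫ h, Φ 0 h ∂(transcript σ π O 0) + (t + 1 : ℕ) * C := by
          push_cast; linarith

end Transcript

section Instance

variable {d : ℕ} {B : ℝ} {X : Set (Euc d)} (I : Instance X B)

lemma Instance.memLp_two_oracle (x : X) : MemLp (fun g : Euc d => g) 2 (I.O x) :=
  memLp_two_of_lintegral_enorm_sq_le (by fun_prop) (I.meanSquare x)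

lemma Instance.integral_norm_sq_le (x : X) : ∫ g, ‖g‖ ^ 2 ∂(I.O x) ≤ B ^ 2 :=
  integral_norm_sq_le_of_lintegral_enorm_sq_le (by fun_prop) (sq_nonneg B) (I.meanSquare x)

lemma Instance.norm_integral_le (x : X) : ‖∫ g, g ∂(I.O x)‖ ≤ |B| := by
  have hvar := variance_nonneg (fun g : Euc d => ‖g‖) (I.O x)
  rw [variance_eq_sub (I.memLp_two_oracle x).norm] at hvar
  refine (norm_integral_le_integral_norm _).trans (le_trans (le_abs_self _) (sq_le_sq.1 ?_))
  exact (sub_nonneg.1 hvar).trans (I.integral_norm_sq_le x)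

lemma Instance.sub_le (x y : X) : I.f x - I.f y ≤ |B| * ‖(x : Euc d) - y‖ := by
  have hsub := I.unbiased x y y.2
  rw [← neg_sub (x : Euc d) y, inner_neg_right] at hsub
  have hinner := (real_inner_le_norm (∫ g, g ∂(I.O x)) ((x : Euc d) - y)).trans
    (mul_le_mul_of_nonneg_right (I.norm_integral_le x) (norm_nonneg _))
  linarith

lemma Instance.abs_sub_le (x y : X) : |I.f x - I.f y| ≤ |B| * ‖(x : Euc d) - y‖ :=
  abs_sub_le_iff.2 ⟨I.sub_le x y, norm_sub_rev (x : Euc d) y ▸ I.sub_le y x⟩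

lemma Instance.abs_sub_le_of_mem_domains {D : ℝ} (hX : X ∈ domains d D) (x y : X) :
    |I.f x - I.f y| ≤ |B| * D :=
  (I.abs_sub_le x y).trans (mul_le_mul_of_nonneg_left (hX.2.2 x x.2 y y.2) (abs_nonneg B))

lemma Instance.measurable_f : Measurable fun x : X => I.f x := by
  refine (LipschitzWith.of_dist_le_mul (K := Real.nnabs B) fun x y => ?_).continuous.measurable
  simpa [Real.dist_eq, Subtype.dist_eq, dist_eq_norm] using I.abs_sub_le x y

lemma Instance.integrable_comp_f {D : ℝ} (hX : X ∈ domains d D) {Ω : Type*} [MeasurableSpace Ω]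
    {μ : Measure Ω} [IsFiniteMeasure μ] {Y : Ω → X} (hY : Measurable Y) :
    Integrable (fun ω => I.f (Y ω)) μ := by
  obtain ⟨x₀, hx₀⟩ := hX.1
  refine .of_bound (I.measurable_f.comp hY).aestronglyMeasurable (|I.f x₀| + |B| * D)
    (ae_of_all _ fun ω => ?_)
  have h := abs_add_le (I.f x₀) (I.f (Y ω) - I.f x₀)
  rw [add_sub_cancel] at h
  exact h.trans (add_le_add_right (I.abs_sub_le_of_mem_domains hX (Y ω) ⟨x₀, hx₀⟩) _)

end Instance

section ApproxProj

lemma exists_measurable_dist_lt {E : Type*} [PseudoMetricSpace E] [SecondCountableTopology E]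
    [MeasurableSpace E] [OpensMeasurableSpace E] {X : Set E} (hX : X.Nonempty) {r : E → ℝ}
    (hr : Measurable r) (hlt : ∀ y, Metric.infDist y X < r y) :
    ∃ p : E → X, Measurable p ∧ ∀ y, dist y (p y : E) < r y := by
  classical
  have : Nonempty X := hX.to_subtype
  have hex (y : E) : ∃ n, dist y (TopologicalSpace.denseSeq X n) < r y := by
    obtain ⟨x, hx, hxy⟩ := (Metric.infDist_lt_iff hX).1 (hlt y)
    exact (TopologicalSpace.denseRange_denseSeq X).exists_mem_open
      (s := {z : X | dist y z < r y}) (isOpen_lt (by fun_prop) (by fun_prop)) ⟨⟨x, hx⟩, hxy⟩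
  refine ⟨fun y => TopologicalSpace.denseSeq X (Nat.find (hex y)), ?_,
    fun y => Nat.find_spec (hex y)⟩
  exact Measurable.find (fun _ => measurable_const)
    (fun n => measurableSet_lt (by fun_prop) hr) hex

variable {E : Type*} [NormedAddCommGroup E] {X : Set E} {δ : ℝ}

/-- `p` is a projection onto `X` up to an error `δ`: it moves no point away from a point of `X`
by more than `δ`, in squared distance. Exact projections do not exist when `X` is not closed. -/
def IsApproxProj (X : Set E) (δ : ℝ) (p : E → X) : Prop :=
  ∀ y, ∀ x ∈ X, ‖(p y : E) - x‖ ^ 2 ≤ ‖y - x‖ ^ 2 + δ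

variable [InnerProductSpace ℝ E]

-- Compare `z` with the point of the segment from `z` to `x` at relative distance `r`.
lemma norm_sub_sq_le_of_le_infDist_sq_add (hX : Convex ℝ X) {x z : E} (hx : x ∈ X) (hz : z ∈ X)
    {y : E} {ε r : ℝ} (hr : 0 < r) (hr1 : r ≤ 1) (hy : ‖y - z‖ ^ 2 ≤ Metric.infDist y X ^ 2 + ε) :
    ‖z - x‖ ^ 2 ≤ ‖y - x‖ ^ 2 + (ε / r + r * ‖z - x‖ ^ 2) := by
  have hmem : z + r • (x - z) ∈ X := hX.add_smul_sub_mem hz hx ⟨hr.le, hr1⟩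
  have hle : Metric.infDist y X ^ 2 ≤ ‖y - (z + r • (x - z))‖ ^ 2 := by
    rw [← dist_eq_norm]
    exact pow_le_pow_left₀ Metric.infDist_nonneg (Metric.infDist_le_dist_of_mem hmem) 2
  rw [← sub_sub, norm_sub_sq_real, inner_smul_right, norm_smul, mul_pow, Real.norm_eq_abs, sq_abs,
    norm_sub_rev x z] at hle
  have hinner : 2 * inner ℝ (y - z) (x - z) ≤ ε / r + r * ‖z - x‖ ^ 2 := by
    refine le_of_mul_le_mul_left ?_ hr
    rw [mul_add, mul_div_cancel₀ _ hr.ne']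
    linarith
  have hxy := norm_sub_sq_real (y - z) (x - z)
  rw [sub_sub_sub_cancel_right, norm_sub_rev x z] at hxy
  linarith [sq_nonneg ‖y - z‖]

lemma exists_measurable_isApproxProj [SecondCountableTopology E] [MeasurableSpace E]
    [OpensMeasurableSpace E] (hne : X.Nonempty) (hX : Convex ℝ X) {D : ℝ}
    (hD : ∀ x ∈ X, ∀ y ∈ X, ‖x - y‖ ≤ D) (hδ : 0 < δ) :
    ∃ p : E → X, Measurable p ∧ IsApproxProj X δ p := by
  obtain ⟨r, hr, hr1, hrD⟩ : ∃ r : ℝ, 0 < r ∧ r ≤ 1 ∧ r * D ^ 2 ≤ δ / 2 := by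
    refine ⟨min 1 (δ / 2 / (D ^ 2 + 1)), by positivity, min_le_left _ _, ?_⟩
    calc min 1 (δ / 2 / (D ^ 2 + 1)) * D ^ 2 ≤ δ / 2 / (D ^ 2 + 1) * (D ^ 2 + 1) := by
          gcongr
          · exact min_le_right _ _
          · linarith
      _ = δ / 2 := div_mul_cancel₀ _ (by positivity)
  have hε : 0 < r * (δ / 2) := by positivity
  obtain ⟨p, hp, hpr⟩ := exists_measurable_dist_lt hne
    (r := fun y : E => √(Metric.infDist y X ^ 2 + r * (δ / 2)))
    ((((Metric.continuous_infDist_pt X).measurable.pow_const 2).add_const _).sqrt)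
    fun y => Real.lt_sqrt_of_sq_lt (by linarith)
  refine ⟨p, hp, fun y x hx => ?_⟩
  have hnear : ‖y - p y‖ ^ 2 ≤ Metric.infDist y X ^ 2 + r * (δ / 2) := by
    have hsq := (Real.lt_sqrt dist_nonneg).1 (hpr y)
    rw [dist_eq_norm] at hsq
    exact hsq.le
  have h := norm_sub_sq_le_of_le_infDist_sq_add hX hx (p y).2 hr hr1 hnear
  have hdiam : ‖(p y : E) - x‖ ^ 2 ≤ D ^ 2 := by
    gcongr
    exact hD _ (p y).2 x hx
  rw [mul_div_cancel_left₀ _ hr.ne'] at h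
  linarith [mul_le_mul_of_nonneg_left hdiam hr.le]

lemma IsApproxProj.integral_norm_sub_sq_le [CompleteSpace E] {p : E → X} (hp : IsApproxProj X δ p)
    {Ω : Type*} [MeasurableSpace Ω] {μ : Measure Ω} [IsProbabilityMeasure μ] {G : Ω → E}
    (hG : MemLp G 2 μ) (η : ℝ) (x : E) {y : E} (hy : y ∈ X) :
    ∫ ω, ‖(p (x - η • G ω) : E) - y‖ ^ 2 ∂μ ≤
      ‖x - y‖ ^ 2 - 2 * η * inner ℝ (∫ ω, G ω ∂μ) (x - y) + η ^ 2 * ∫ ω, ‖G ω‖ ^ 2 ∂μ + δ := by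
  have hG1 : Integrable G μ := hG.integrable one_le_two
  have hlin : Integrable (fun ω => 2 * η * inner ℝ (x - y) (G ω)) μ :=
    (hG1.const_inner (x - y)).const_mul (2 * η)
  have hsq : Integrable (fun ω => η ^ 2 * ‖G ω‖ ^ 2) μ :=
    (hG.integrable_norm_pow two_ne_zero).const_mul (η ^ 2)
  have hsub : Integrable (fun ω => ‖x - y‖ ^ 2 + δ - 2 * η * inner ℝ (x - y) (G ω)) μ :=
    (integrable_const _).sub hlin
  have hpt (ω : Ω) : ‖(p (x - η • G ω) : E) - y‖ ^ 2 ≤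
      ‖x - y‖ ^ 2 + δ - 2 * η * inner ℝ (x - y) (G ω) + η ^ 2 * ‖G ω‖ ^ 2 := by
    refine (hp _ y hy).trans_eq ?_
    rw [sub_right_comm, norm_sub_sq_real, inner_smul_right, norm_smul, mul_pow, Real.norm_eq_abs,
      sq_abs]
    ring
  calc ∫ ω, ‖(p (x - η • G ω) : E) - y‖ ^ 2 ∂μ
      ≤ ∫ ω, (‖x - y‖ ^ 2 + δ - 2 * η * inner ℝ (x - y) (G ω) + η ^ 2 * ‖G ω‖ ^ 2) ∂μ :=
        integral_mono_of_nonneg (ae_of_all _ fun _ => sq_nonneg _)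
          (hsub.add hsq) (ae_of_all _ hpt)
    _ = _ := by
        rw [integral_add hsub hsq, integral_sub (integrable_const _) hlin,
          integral_const_mul, integral_const_mul, integral_inner hG1, integral_const, probReal_univ,
          one_smul, real_inner_comm]
        ring

end ApproxProj

section SGD

variable {d ℓ : ℕ} {B P D σ V δ η : ℝ} {X : Set (Euc d)}

/-- One step of projected gradient descent with averaging. The state is the average of the past
iterates together with the current iterate, and `t` is the number of iterates averaged so far. -/
def sgdStep (hX : Convex ℝ X) (p : Euc d → X) (η : ℝ) (t : ℕ) (s : X × X) (g : Euc d) : X × X :=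
  (⟨((t : ℝ) / (t + 1)) • (s.1 : Euc d) + (1 / ((t : ℝ) + 1)) • (s.2 : Euc d),
    hX s.1.2 s.2.2 (by positivity) (by positivity) (by field_simp)⟩, p (s.2 - η • g))

lemma measurable_sgdStep (hX : Convex ℝ X) {p : Euc d → X} (hp : Measurable p) (η : ℝ) (t : ℕ) :
    Measurable fun q : (X × X) × Euc d => sgdStep hX p η t q.1 q.2 :=
  (Measurable.subtype_mk (by fun_prop)).prodMk (hp.comp (by fun_prop))

/-- The state of projected gradient descent started at `x₀`, after `t` gradient estimates. -/
def sgdState (hX : Convex ℝ X) (p : Euc d → X) (η : ℝ) (x₀ : X) :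
    (t : ℕ) → (Fin t → Euc d) → X × X
  | 0, _ => (x₀, x₀)
  | t + 1, g => sgdStep hX p η t (sgdState hX p η x₀ t (Fin.init g)) (g (Fin.last t))

lemma measurable_sgdState (hX : Convex ℝ X) {p : Euc d → X} (hp : Measurable p) (η : ℝ) (x₀ : X) :
    ∀ t, Measurable (sgdState hX p η x₀ t)
  | 0 => measurable_const
  | t + 1 =>
    have hinit : Measurable fun g : Fin (t + 1) → Euc d => (Fin.init g : Fin t → Euc d) :=
      measurable_pi_lambda _ fun i => measurable_pi_apply i.castSucc
    (measurable_sgdStep hX hp η t).comp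
      (((measurable_sgdState hX hp η x₀ t).comp hinit).prodMk (measurable_pi_apply (Fin.last t)))

/-- Projected stochastic gradient descent on the gradient estimates that `dec` extracts from the
observations. The output is the average of the iterates. -/
def sgdAlgorithm {c : Code d ℓ B P} {dec : Obs c → Euc d} (hdec : Measurable dec)
    (hX : Convex ℝ X) {p : Euc d → X} (hp : Measurable p) (η : ℝ) (x₀ : X) (T : ℕ) :
    Algorithm X c T where
  W := Unit
  mW := inferInstance
  lawW := Measure.dirac ()
  probW := inferInstance
  query t h := (sgdState hX p η x₀ t fun i => dec (h.2 i)).2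
  measurable_query t := measurable_snd.comp ((measurable_sgdState hX hp η x₀ t).comp (by fun_prop))
  output h := (sgdState hX p η x₀ T fun i => dec (h.2 i)).1
  measurable_output := measurable_fst.comp ((measurable_sgdState hX hp η x₀ T).comp (by fun_prop))

/-- The potential of the analysis of gradient descent against the comparison point `y`: what the
average has lost so far, plus the squared distance of the iterate from `y`. -/
def sgdPotential (I : Instance X B) (η : ℝ) (y : X) (t : ℕ) (s : X × X) : ℝ :=
  2 * η * t * (I.f s.1 - I.f y) + ‖(s.2 : Euc d) - y‖ ^ 2

lemma measurable_sgdPotential (I : Instance X B) (η : ℝ) (y : X) (t : ℕ) :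
    Measurable (sgdPotential I η y t) :=
  (((I.measurable_f.comp measurable_fst).sub_const _).const_mul _).add (by fun_prop)

lemma abs_sgdPotential_le (hX : X ∈ domains d D) (I : Instance X B) (hη : 0 ≤ η) (y : X) (t : ℕ)
    (s : X × X) : |sgdPotential I η y t s| ≤ 2 * η * t * (|B| * D) + D ^ 2 := by
  refine (abs_add_le _ _).trans (add_le_add ?_ ?_)
  · rw [abs_mul, abs_of_nonneg (by positivity)]
    exact mul_le_mul_of_nonneg_left (I.abs_sub_le_of_mem_domains hX _ _) (by positivity)
  · rw [abs_of_nonneg (by positivity)]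
    exact pow_le_pow_left₀ (norm_nonneg _) (hX.2.2 _ s.2.2 _ y.2) 2

lemma sgdPotential_sgdStep_le (hX : Convex ℝ X) (I : Instance X B) (p : Euc d → X) (hη : 0 ≤ η)
    (y : X) (t : ℕ) (s : X × X) (g : Euc d) :
    sgdPotential I η y (t + 1) (sgdStep hX p η t s g) ≤
      2 * η * t * (I.f s.1 - I.f y) + 2 * η * (I.f s.2 - I.f y) +
        ‖(p (s.2 - η • g) : Euc d) - y‖ ^ 2 := by
  have hconv := mul_le_mul_of_nonneg_left (I.convex.2 s.1.2 s.2.2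
    (by positivity : 0 ≤ (t : ℝ) / (t + 1)) (by positivity : 0 ≤ 1 / ((t : ℝ) + 1))
    (by field_simp)) (by positivity : 0 ≤ 2 * η * ((t : ℝ) + 1))
  have havg : 2 * η * ((t : ℝ) + 1) *
      (((t : ℝ) / (t + 1)) • I.f s.1 + (1 / ((t : ℝ) + 1)) • I.f s.2) =
      2 * η * t * I.f s.1 + 2 * η * I.f s.2 := by
    simp only [smul_eq_mul]
    field_simp
  simp only [sgdPotential, sgdStep]
  push_cast
  linarith

/-- For oracles on `X`, the decoder `dec` turns the observations into unbiased gradient estimates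
of second moment at most `V`. -/
structure IsUnbiasedDecoder (X : Set (Euc d)) (c : Code d ℓ B P) (σ V : ℝ)
    (dec : Obs c → Euc d) : Prop where
  measurable : Measurable dec
  memLp (I : Instance X B) (x : X) : MemLp dec 2 (observe c σ I.O x)
  integral_eq (I : Instance X B) (x : X) : ∫ o, dec o ∂(observe c σ I.O x) = ∫ g, g ∂(I.O x)
  integral_norm_sq_le (I : Instance X B) (x : X) : ∫ o, ‖dec o‖ ^ 2 ∂(observe c σ I.O x) ≤ V

variable {c : Code d ℓ B P} {dec : Obs c → Euc d} {p : Euc d → X}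

lemma integral_sgdPotential_sgdStep_le (hX : X ∈ domains d D) (I : Instance X B)
    (hdec : IsUnbiasedDecoder X c σ V dec) (hp : Measurable p) (hpδ : IsApproxProj X δ p)
    (hη : 0 ≤ η) (y : X) (t : ℕ) (s : X × X) :
    ∫ o, sgdPotential I η y (t + 1) (sgdStep hX.2.1 p η t s (dec o)) ∂(observe c σ I.O s.2) ≤
      sgdPotential I η y t s + (η ^ 2 * V + δ) := by
  set μ := observe c σ I.O s.2
  have hpdec : Measurable fun o => p (s.2 - η • dec o) :=
    hp.comp ((hdec.measurable.const_smul η).const_sub _)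
  have hdist : Integrable (fun o => ‖(p (s.2 - η • dec o) : Euc d) - y‖ ^ 2) μ :=
    .of_bound (((measurable_subtype_coe.comp hpdec).sub_const _).norm.pow_const 2
      |>.aestronglyMeasurable) (D ^ 2) (ae_of_all _ fun o => by
      simpa using pow_le_pow_left₀ (norm_nonneg _) (hX.2.2 _ (p (s.2 - η • dec o)).2 y y.2) 2)
  have hpot : Integrable
      (fun o => sgdPotential I η y (t + 1) (sgdStep hX.2.1 p η t s (dec o))) μ :=
    .of_bound ((measurable_sgdPotential I η y _).comp ((measurable_sgdStep hX.2.1 hp η t).comp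
      (measurable_const.prodMk hdec.measurable))).aestronglyMeasurable _
      (ae_of_all _ fun o => abs_sgdPotential_le hX I hη y _ _)
  have hmono := integral_mono hpot ((integrable_const _).add hdist)
    fun o => sgdPotential_sgdStep_le hX.2.1 I p hη y t s (dec o)
  rw [integral_add' (integrable_const _) hdist, integral_const, probReal_univ, one_smul] at hmono
  have hstep := hpδ.integral_norm_sub_sq_le (hdec.memLp I s.2) η s.2 y.2
  have hsub := I.unbiased s.2 y y.2
  rw [← neg_sub (s.2 : Euc d) y, inner_neg_right, ← hdec.integral_eq] at hsub
  have hVη := mul_le_mul_of_nonneg_left (hdec.integral_norm_sq_le I s.2) (sq_nonneg η)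
  have hsubη := mul_le_mul_of_nonneg_left hsub (by positivity : 0 ≤ 2 * η)
  refine hmono.trans ?_
  simp only [sgdPotential]
  linarith

lemma integral_sgdPotential_le (hX : X ∈ domains d D) (I : Instance X B)
    (hdec : IsUnbiasedDecoder X c σ V dec) (hp : Measurable p) (hpδ : IsApproxProj X δ p)
    (hη : 0 ≤ η) (x₀ y : X) (T : ℕ) :
    ∫ h, sgdPotential I η y T (sgdState hX.2.1 p η x₀ T fun i => dec (h.2 i))
        ∂(transcript σ (sgdAlgorithm hdec.measurable hX.2.1 hp η x₀ T) I.O T) ≤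
      D ^ 2 + T * (η ^ 2 * V + δ) := by
  have hm := hdec.measurable
  refine (integral_transcript_le_of_drift (sgdAlgorithm hm hX.2.1 hp η x₀ T) I.O
    (C := η ^ 2 * V + δ)
    (Φ := fun t h => sgdPotential I η y t (sgdState hX.2.1 p η x₀ t fun i => dec (h.2 i)))
    (fun t => (measurable_sgdPotential I η y t).comp
      ((measurable_sgdState hX.2.1 hp η x₀ t).comp (by fun_prop)))
    (fun t => ⟨_, fun h => abs_sgdPotential_le hX I hη y t _⟩) (fun t q => ?_) T).trans ?_
  · convert integral_sgdPotential_sgdStep_le hX I hdec hp hpδ hη y t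
      (sgdState hX.2.1 p η x₀ t fun i => dec (q.2 i)) using 3 with o
    · rfl
    · simp [sgdState, Fin.init_def]
  · have hstart : ‖(x₀ : Euc d) - y‖ ^ 2 ≤ D ^ 2 :=
      pow_le_pow_left₀ (norm_nonneg _) (hX.2.2 x₀ x₀.2 y y.2) 2
    simpa [sgdPotential, sgdState] using hstart

lemma convError_sgdAlgorithm_le (hX : X ∈ domains d D) (I : Instance X B)
    (hdec : IsUnbiasedDecoder X c σ V dec) (hp : Measurable p) (hpδ : IsApproxProj X δ p)
    (hη : 0 < η) (x₀ : X) {T : ℕ} (hT : 0 < T) :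
    convError σ (sgdAlgorithm hdec.measurable hX.2.1 hp η x₀ T) I ≤
      (D ^ 2 + T * (η ^ 2 * V + δ)) / (2 * η * T) := by
  set π := sgdAlgorithm hdec.measurable hX.2.1 hp η x₀ T
  have hf : Integrable (fun h => I.f (π.output h)) (transcript σ π I.O T) :=
    I.integrable_comp_f hX π.measurable_output
  have hpot (y : X) : Integrable (fun h => sgdPotential I η y T
      (sgdState hX.2.1 p η x₀ T fun i => dec (h.2 i))) (transcript σ π I.O T) :=
    .of_bound ((measurable_sgdPotential I η y T).comp ((measurable_sgdState hX.2.1 hp η x₀ T).comp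
      (by have := hdec.measurable; fun_prop))).aestronglyMeasurable _
      (ae_of_all _ fun h => abs_sgdPotential_le hX I hη.le y T _)
  have hbound (y : X) : ∫ h, I.f (π.output h) ∂(transcript σ π I.O T) -
      (D ^ 2 + T * (η ^ 2 * V + δ)) / (2 * η * T) ≤ I.f y := by
    have hle := (integral_mono ((hf.sub (integrable_const (I.f y))).const_mul (2 * η * T)) (hpot y)
      fun h => le_add_of_nonneg_right (sq_nonneg _)).trans
        (integral_sgdPotential_le hX I hdec hp hpδ hη.le x₀ y T)
    rw [integral_const_mul, integral_sub' hf (integrable_const _), integral_const, probReal_univ,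
      one_smul] at hle
    rw [sub_le_comm, le_div_iff₀' (by positivity)]
    exact hle
  have : Nonempty X := ⟨x₀⟩
  unfold convError
  linarith [le_ciInf hbound]

lemma exists_worstError_le (hD : 0 < D) (hX : X ∈ domains d D) (hV : 0 < V)
    (hdec : IsUnbiasedDecoder X c σ V dec) {T : ℕ} (hT : 0 < T) :
    ∃ π : Algorithm X c T, worstError σ π ≤ ((3 / 2 * D * √(V / T) : ℝ) : EReal) := by
  obtain ⟨x₀, hx₀⟩ := hX.1
  obtain ⟨p, hp, hpδ⟩ :=
    exists_measurable_isApproxProj hX.1 hX.2.1 hX.2.2 (by positivity : 0 < D ^ 2 / T)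
  set S := √(V / T) with hS
  have hSpos : 0 < S := by positivity
  have hη : 0 < D / (T * S) := by positivity
  refine ⟨sgdAlgorithm hdec.measurable hX.2.1 hp (D / (T * S)) ⟨x₀, hx₀⟩ T,
    iSup_le fun I => EReal.coe_le_coe_iff.2 ?_⟩
  refine (convError_sgdAlgorithm_le hX I hdec hp hpδ hη ⟨x₀, hx₀⟩ hT).trans_eq ?_
  have hVS : V = S ^ 2 * T := by
    rw [hS, Real.sq_sqrt (by positivity), div_mul_cancel₀ _ (by positivity)]
  rw [hVS]
  field_simp
  norm_num

end SGD

section InnerProd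

variable {Ω Ω' E : Type*} [MeasurableSpace Ω] [MeasurableSpace Ω'] [NormedAddCommGroup E]
  [InnerProductSpace ℝ E] {μ : Measure Ω} {ν : Measure Ω'} {f : Ω → E} {h : Ω' → E}

lemma integrable_inner_prod [IsFiniteMeasure μ] [IsFiniteMeasure ν] (hf : MemLp f 2 μ)
    (hh : MemLp h 2 ν) :
    Integrable (fun p : Ω × Ω' => inner ℝ (f p.1) (h p.2)) (μ.prod ν) := by
  have hf' : MemLp (fun p : Ω × Ω' => f p.1) 2 (μ.prod ν) := hf.comp_fst ν
  have hh' : MemLp (fun p : Ω × Ω' => h p.2) 2 (μ.prod ν) := hh.comp_snd μ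
  refine ((hf'.integrable_norm_pow two_ne_zero).add (hh'.integrable_norm_pow two_ne_zero)).mono'
    (hf'.1.inner hh'.1) (ae_of_all _ fun p => (norm_inner_le_norm _ _).trans ?_)
  simp only [Pi.add_apply]
  linarith [two_mul_le_add_sq ‖f p.1‖ ‖h p.2‖,
    mul_nonneg (norm_nonneg (f p.1)) (norm_nonneg (h p.2))]

lemma integral_inner_prod_eq_zero [CompleteSpace E] [IsFiniteMeasure μ] [IsFiniteMeasure ν]
    (hf : MemLp f 2 μ) (hh : MemLp h 2 ν) (hh0 : ∫ y, h y ∂ν = 0) :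
    ∫ p, inner ℝ (f p.1) (h p.2) ∂(μ.prod ν) = 0 := by
  rw [integral_prod _ (integrable_inner_prod hf hh)]
  simp [integral_inner (hh.integrable one_le_two), hh0]

lemma integral_norm_add_sq_prod [CompleteSpace E] [IsProbabilityMeasure μ]
    [IsProbabilityMeasure ν] (hf : MemLp f 2 μ) (hh : MemLp h 2 ν) (hh0 : ∫ y, h y ∂ν = 0) :
    ∫ p, ‖f p.1 + h p.2‖ ^ 2 ∂(μ.prod ν) = ∫ x, ‖f x‖ ^ 2 ∂μ + ∫ y, ‖h y‖ ^ 2 ∂ν := by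
  have hsqf := (hf.comp_fst ν).integrable_norm_pow two_ne_zero
  have hsqh := (hh.comp_snd μ).integrable_norm_pow two_ne_zero
  have hinner := integrable_inner_prod hf hh
  simp_rw [norm_add_sq_real]
  rw [integral_add (by exact hsqf.add (hinner.const_mul 2)) hsqh,
    integral_add hsqf (hinner.const_mul 2), integral_const_mul,
    integral_inner_prod_eq_zero hf hh hh0]
  simp [integral_fun_fst (μ := μ) (ν := ν) (fun x => ‖f x‖ ^ 2),
    integral_fun_snd (μ := μ) (ν := ν) (fun y => ‖h y‖ ^ 2)]

end InnerProd

section ScaledTransmission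

variable (d : ℕ) (B P : ℝ) (hB : 0 < B) (hP : 0 < P)

/-- Scaled transmission as a code without public randomness. -/
def scaledCode : Code d d B P where
  U := Unit
  mU := inferInstance
  lawU := Measure.dirac ()
  probU := inferInstance
  enc g _ := (√(P * d) / B) • g
  measurable_enc := by
    change Measurable fun p : Euc d × Unit => (√(P * d) / B) • p.1
    fun_prop
  power ν _ hν := by
    have hscale (g : Euc d) :
        ‖(√(P * d) / B) • g‖ₑ ^ 2 = ENNReal.ofReal (P * d / B ^ 2) * ‖g‖ₑ ^ 2 := by
      rw [enorm_smul, mul_pow, Real.enorm_eq_ofReal (by positivity),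
        ← ENNReal.ofReal_pow (by positivity), div_pow, Real.sq_sqrt (by positivity)]
    simp only [lintegral_const, measure_univ, mul_one, hscale]
    rw [lintegral_const_mul _ (by fun_prop)]
    refine (mul_le_mul_right hν _).trans_eq ?_
    rw [← ENNReal.ofReal_mul (by positivity)]
    congr 1
    field_simp

lemma scaledCode_mem_scaledTransmission :
    scaledCode d B P hB hP ∈ scaledTransmission d B P d :=
  ⟨rfl, fun g _ i => by simp [scaledCode]⟩

/-- The gradient estimate obtained by undoing the scaling of scaled transmission. -/
def scaledDecoder (o : Obs (scaledCode d B P hB hP)) : Euc d := (B / √(P * d)) • o.2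

variable {d B P}

lemma scaledDecoder_channelOutput (hd : 0 < d)
    (p : Euc d × (scaledCode d B P hB hP).U × Euc d) :
    scaledDecoder d B P hB hP (p.2.1, (scaledCode d B P hB hP).enc p.1 p.2.1 + p.2.2) =
      p.1 + (B / √(P * d)) • p.2.2 := by
  simp only [scaledDecoder, scaledCode, smul_add, smul_smul]
  rw [div_mul_div_cancel₀ (by positivity), div_self hB.ne', one_smul]

lemma isUnbiasedDecoder_scaledDecoder (hd : 0 < d) (σ : ℝ) (X : Set (Euc d)) :
    IsUnbiasedDecoder X (scaledCode d B P hB hP) σ (B ^ 2 * (1 + σ ^ 2 / P))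
      (scaledDecoder d B P hB hP) := by
  have hdec : Measurable (scaledDecoder d B P hB hP) := by
    unfold scaledDecoder
    fun_prop
  have hout := measurable_channelOutput (scaledCode d B P hB hP)
  set ρ := (scaledCode d B P hB hP).lawU.prod (noise d σ)
  have hnoise : MemLp (fun q : (scaledCode d B P hB hP).U × Euc d => (B / √(P * d)) • q.2) 2 ρ :=
    ((memLp_two_noise d σ).const_smul (B / √(P * d))).comp_snd _
  have hnoise0 : ∫ q, (B / √(P * d)) • q.2 ∂ρ = 0 := by
    rw [integral_fun_snd (fun z : Euc d => (B / √(P * d)) • z), integral_smul, integral_id_noise,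
      smul_zero, smul_zero]
  have hnoise2 : ∫ q, ‖(B / √(P * d)) • q.2‖ ^ 2 ∂ρ = B ^ 2 * (σ ^ 2 / P) := by
    simp_rw [norm_smul, mul_pow, Real.norm_eq_abs, sq_abs, div_pow]
    rw [Real.sq_sqrt (by positivity), integral_const_mul,
      integral_fun_snd (fun z : Euc d => ‖z‖ ^ 2), integral_norm_sq_noise, probReal_univ, one_smul]
    field_simp
  refine ⟨hdec, fun I x => ?_, fun I x => ?_, fun I x => ?_⟩ <;> rw [observe_apply]
  · refine (memLp_map_measure_iff hdec.aestronglyMeasurable hout.aemeasurable).2 ?_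
    exact (((I.memLp_two_oracle x).comp_fst ρ).add (hnoise.comp_snd _)).ae_eq
      (ae_of_all _ fun p => (scaledDecoder_channelOutput hB hP hd p).symm)
  · rw [integral_map hout.aemeasurable hdec.aestronglyMeasurable]
    simp_rw [scaledDecoder_channelOutput hB hP hd]
    rw [integral_add (((I.memLp_two_oracle x).integrable one_le_two).comp_fst ρ)
      ((hnoise.integrable one_le_two).comp_snd _), integral_fun_fst (fun g => g),
      integral_fun_snd (μ := I.O x) (ν := ρ) (fun q => (B / √(P * d)) • q.2), hnoise0,
      probReal_univ, one_smul, smul_zero, add_zero]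
  · rw [integral_map hout.aemeasurable (hdec.norm.pow_const 2).aestronglyMeasurable]
    simp_rw [scaledDecoder_channelOutput hB hP hd]
    rw [integral_norm_add_sq_prod (I.memLp_two_oracle x) hnoise hnoise0, hnoise2]
    linarith [I.integral_norm_sq_le x]

lemma logb_two_one_add_le {s : ℝ} (hs : 0 ≤ s) : Real.logb 2 (1 + s) ≤ 2 * s := by
  rw [Real.logb, div_le_iff₀ (Real.log_pos one_lt_two)]
  nlinarith [Real.log_le_sub_one_of_pos (by positivity : 0 < 1 + s), Real.log_two_gt_d9]

lemma le_logb_two_one_add {s : ℝ} (hs : 0 ≤ s) (hs1 : s ≤ 1) : s ≤ Real.logb 2 (1 + s) := by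
  rw [Real.le_logb_iff_rpow_le one_lt_two (by positivity)]
  have h := rpow_one_add_le_one_add_mul_self (s := 1) (by norm_num) hs hs1
  rwa [one_add_one_eq_two, mul_one] at h

lemma logb_two_one_add_le_one {s : ℝ} (hs : 0 ≤ s) (hs1 : s ≤ 1) : Real.logb 2 (1 + s) ≤ 1 := by
  rw [Real.logb_le_iff_le_rpow one_lt_two (by positivity), Real.rpow_one]
  linarith

lemma minimaxError_anti {C C' : CodeClass d B P} (h : ∀ ℓ, C ℓ ⊆ C' ℓ) (D σ : ℝ) (N : ℕ) :
    minimaxError C' D σ N ≤ minimaxError C D σ N :=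
  iSup₂_mono fun _ _ => iInf₂_mono fun ℓ _ => iInf₂_mono fun _ _ => iInf_mono fun _ =>
    le_iInf fun hc => iInf_le_of_le (h ℓ hc) le_rfl

lemma scaledTransmission_subset_analogCodes (d : ℕ) (B P : ℝ) (ℓ : ℕ) :
    scaledTransmission d B P ℓ ⊆ analogCodes d B P ℓ := by
  rintro c ⟨rfl, hc⟩
  refine ⟨le_rfl, fun _ => Matrix.diagonal fun _ => √(P * ℓ) / B, fun g u i => ?_⟩
  rw [hc]
  simp [Matrix.diagonal_apply]

lemma minimaxError_scaledTransmission_le {N : ℕ} {D σ : ℝ} (hd : 0 < d) (hdN : d ≤ N) (hD : 0 < D)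
    (hB : 0 < B) (hP : 0 < P) :
    minimaxError (scaledTransmission d B P) D σ N ≤
      ((3 / 2 * D * √(2 * d * (B ^ 2 * (1 + σ ^ 2 / P)) / N) : ℝ) : EReal) := by
  have hT : 0 < N / d := Nat.div_pos hdN hd
  have hNT : (N : ℝ) ≤ 2 * d * (N / d : ℕ) := by
    have hlt : N < d * (N / d + 1) := Nat.lt_mul_div_succ N hd
    exact_mod_cast (by nlinarith : N ≤ 2 * d * (N / d))
  refine iSup₂_le fun X hX => ?_
  obtain ⟨π, hπ⟩ := exists_worstError_le hD hX (by positivity)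
    (isUnbiasedDecoder_scaledDecoder hB hP hd σ X) hT
  refine (iInf₂_le_of_le d hd <| iInf₂_le_of_le (N / d) (Nat.mul_div_le N d) <|
    iInf₂_le_of_le _ (scaledCode_mem_scaledTransmission d B P hB hP) <|
    iInf_le_of_le π hπ).trans (EReal.coe_le_coe_iff.2 ?_)
  have hN : (0 : ℝ) < N := by exact_mod_cast hd.trans_le hdN
  have hT' : (0 : ℝ) < (N / d : ℕ) := by exact_mod_cast hT
  gcongr 3 / 2 * D * √?_
  rw [div_le_div_iff₀ hT' hN]
  calc B ^ 2 * (1 + σ ^ 2 / P) * N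
      ≤ B ^ 2 * (1 + σ ^ 2 / P) * (2 * d * (N / d : ℕ)) := by gcongr
    _ = _ := by ring

lemma minimaxError_scaledTransmission_le_logb {N : ℕ} {D σ : ℝ} (hd : 0 < d) (hD : 0 < D)
    (hB : 0 < B) (hσ : 0 < σ) (hSNR : P / σ ^ 2 ∈ Set.Ioo (0 : ℝ) 1)
    (hN : d / Real.logb 2 (1 + P / σ ^ 2) ≤ N) :
    minimaxError (scaledTransmission d B P) D σ N ≤
      ((5 * (D * B / √N * √(d / Real.logb 2 (1 + P / σ ^ 2))) : ℝ) : EReal) := by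
  obtain ⟨hs, hs1⟩ := hSNR
  have hP : 0 < P := (div_pos_iff_of_pos_right (by positivity)).1 hs
  set C := Real.logb 2 (1 + P / σ ^ 2)
  have hC : 0 < C := Real.logb_pos one_lt_two (by linarith)
  have hdN : (d : ℝ) ≤ N :=
    (le_div_self (by positivity) hC (logb_two_one_add_le_one hs.le hs1.le)).trans hN
  have hd' : (0 : ℝ) < d := by exact_mod_cast hd
  have hN' : (0 : ℝ) < N := hd'.trans_le hdN
  refine (minimaxError_scaledTransmission_le hd (by exact_mod_cast hdN) hD hB hP).trans
    (EReal.coe_le_coe_iff.2 ?_)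
  have hVC : 1 + σ ^ 2 / P ≤ 4 / C := by
    have hinv : σ ^ 2 / P = 1 / (P / σ ^ 2) := (one_div_div _ _).symm
    calc 1 + σ ^ 2 / P ≤ 2 / (P / σ ^ 2) := by
          rw [hinv]
          linarith [(one_le_div hs).2 hs1.le, add_div 1 1 (P / σ ^ 2)]
      _ ≤ 4 / C := by
          rw [div_le_div_iff₀ hs hC]
          linarith [logb_two_one_add_le hs.le]
  have hsqrt : √(2 * d * (B ^ 2 * (1 + σ ^ 2 / P)) / N) ≤ 10 / 3 * (B / √N * √(d / C)) := by
    refine Real.sqrt_le_iff.2 ⟨by positivity, ?_⟩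
    rw [mul_pow, mul_pow, div_pow B, Real.sq_sqrt hN'.le, Real.sq_sqrt (by positivity)]
    calc 2 * d * (B ^ 2 * (1 + σ ^ 2 / P)) / N ≤ 2 * d * (B ^ 2 * (4 / C)) / N := by gcongr
      _ = 8 * (B ^ 2 / N * (d / C)) := by ring
      _ ≤ (10 / 3) ^ 2 * (B ^ 2 / N * (d / C)) := by
          gcongr
          norm_num
  calc 3 / 2 * D * √(2 * d * (B ^ 2 * (1 + σ ^ 2 / P)) / N)
      ≤ 3 / 2 * D * (10 / 3 * (B / √N * √(d / C))) := by gcongr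
    _ = 5 * (D * B / √N * √(d / C)) := by ring

end ScaledTransmission

section Density

lemma map_withDensity_comp {α β : Type*} [MeasurableSpace α] [MeasurableSpace β] (μ : Measure α)
    {e : α → β} (he : Measurable e) {f : β → ℝ≥0∞} (hf : Measurable f) :
    (μ.withDensity (f ∘ e)).map e = (μ.map e).withDensity f := by
  ext s hs
  rw [Measure.map_apply he hs, withDensity_apply _ (he hs), withDensity_apply _ hs,
    setLIntegral_map hs hf he]
  rfl

lemma pi_withDensity {ι : Type*} [Fintype ι] {α : ι → Type*} [∀ i, MeasurableSpace (α i)]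
    (μ : ∀ i, Measure (α i)) [∀ i, IsProbabilityMeasure (μ i)] {f : ∀ i, α i → ℝ≥0∞}
    (hf : ∀ i, Measurable (f i)) [∀ i, SigmaFinite ((μ i).withDensity (f i))] :
    Measure.pi (fun i => (μ i).withDensity (f i)) =
      (Measure.pi μ).withDensity fun x => ∏ i, f i (x i) := by
  classical
  refine Measure.pi_eq fun s hs => ?_
  have hindicator : (Set.univ.pi s).indicator (fun x : ∀ i, α i => ∏ i, f i (x i)) =
      fun x => ∏ i, (s i).indicator (f i) (x i) := by
    ext x
    by_cases hx : x ∈ Set.univ.pi s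
    · rw [Set.indicator_of_mem hx]
      exact Finset.prod_congr rfl fun i _ => (Set.indicator_of_mem (hx i trivial) _).symm
    · obtain ⟨i, hi⟩ : ∃ i, x i ∉ s i := by simpa [Set.mem_pi] using hx
      rw [Set.indicator_of_notMem hx,
        Finset.prod_eq_zero (Finset.mem_univ i) (Set.indicator_of_notMem hi _)]
  have hm (i : ι) : Measurable ((s i).indicator (f i)) := (hf i).indicator (hs i)
  rw [withDensity_apply _ (MeasurableSet.univ_pi hs),
    ← lintegral_indicator (MeasurableSet.univ_pi hs), hindicator,
    lintegral_prod_eq_prod_lintegral_of_indepFun Finset.univ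
      (fun i (x : ∀ i, α i) => (s i).indicator (f i) (x i))
      (iIndepFun_pi fun i => (hm i).aemeasurable) fun i => (hm i).comp (measurable_pi_apply i)]
  refine Finset.prod_congr rfl fun i _ => ?_
  rw [(measurePreserving_eval μ i).lintegral_comp (hm i), lintegral_indicator (hs i),
    withDensity_apply _ (hs i)]

end Density

section GaussianShift

variable {ℓ : ℕ} {σ : ℝ}

lemma gaussianReal_eq_withDensity (a : ℝ) {v : NNReal} (hv : v ≠ 0) :
    gaussianReal a v = (gaussianReal 0 v).withDensity
      fun x => ENNReal.ofReal (Real.exp ((a * x - a ^ 2 / 2) / v)) := by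
  rw [gaussianReal_of_var_ne_zero _ hv, gaussianReal_of_var_ne_zero _ hv,
    ← withDensity_mul _ (measurable_gaussianPDF _ _) (by fun_prop)]
  congr 1
  ext x
  have hv' : (v : ℝ) ≠ 0 := by exact_mod_cast hv
  have hexp : Real.exp (-(x - a) ^ 2 / (2 * v)) =
      Real.exp (-(x - 0) ^ 2 / (2 * v)) * Real.exp ((a * x - a ^ 2 / 2) / v) := by
    rw [← Real.exp_add]
    congr 1
    field_simp
    ring
  rw [Pi.mul_apply, gaussianPDF_def, gaussianPDF_def,
    ← ENNReal.ofReal_mul (gaussianPDFReal_nonneg _ _ _), gaussianPDFReal_def, gaussianPDFReal_def]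
  simp only [hexp, mul_assoc]

/-- The log-likelihood ratio, at the channel output `y`, of the channel input `a` against the
input `0`. -/
def logRatio (σ : ℝ) (a y : Euc ℓ) : ℝ := (inner ℝ a y - ‖a‖ ^ 2 / 2) / σ ^ 2

@[fun_prop]
lemma measurable_logRatio {Ω : Type*} [MeasurableSpace Ω] {a y : Ω → Euc ℓ} (ha : Measurable a)
    (hy : Measurable y) : Measurable fun ω => logRatio σ (a ω) (y ω) := by
  unfold logRatio
  fun_prop

lemma prod_exp_eq_exp_logRatio (a y : Euc ℓ) :
    ∏ i, Real.exp ((a i * y i - a i ^ 2 / 2) / σ ^ 2) = Real.exp (logRatio σ a y) := by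
  rw [← Real.exp_sum, logRatio, EuclideanSpace.real_norm_sq_eq, PiLp.inner_apply,
    ← Finset.sum_div, Finset.sum_sub_distrib, Finset.sum_div]
  simp [mul_comm]

lemma pi_gaussianReal_eq_withDensity (hσ : σ ≠ 0) (a : Euc ℓ) :
    (Measure.pi fun i => gaussianReal (a i) (σ ^ 2).toNNReal) =
      (Measure.pi fun _ : Fin ℓ => gaussianReal 0 (σ ^ 2).toNNReal).withDensity
        fun x => ENNReal.ofReal (Real.exp (logRatio σ a (WithLp.toLp 2 x))) := by
  have hv : (σ ^ 2).toNNReal ≠ 0 := by simpa using hσ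
  have hdensity (i : Fin ℓ) := gaussianReal_eq_withDensity (a i) hv
  have (i : Fin ℓ) : IsProbabilityMeasure ((gaussianReal 0 (σ ^ 2).toNNReal).withDensity
      fun x => ENNReal.ofReal (Real.exp ((a i * x - a i ^ 2 / 2) / (σ ^ 2).toNNReal))) :=
    hdensity i ▸ inferInstance
  rw [funext hdensity, pi_withDensity _ fun i => by fun_prop]
  congr 1
  ext x
  rw [← ENNReal.ofReal_prod_of_nonneg fun _ _ => (Real.exp_pos _).le,
    Real.coe_toNNReal _ (sq_nonneg σ), ← prod_exp_eq_exp_logRatio]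

lemma noise_map_const_add_eq_map_pi (a : Euc ℓ) :
    (noise ℓ σ).map (a + ·) =
      (Measure.pi fun i => gaussianReal (a i) (σ ^ 2).toNNReal).map (WithLp.toLp 2) := by
  have hshift (i : Fin ℓ) : (gaussianReal 0 (σ ^ 2).toNNReal).map (a i + ·) =
      gaussianReal (a i) (σ ^ 2).toNNReal := by
    rw [gaussianReal_map_const_add, zero_add]
  have (i : Fin ℓ) : SigmaFinite ((gaussianReal 0 (σ ^ 2).toNNReal).map (a i + ·)) := by
    rw [hshift]; infer_instance
  rw [← funext hshift, ← Measure.pi_map_pi fun i => by fun_prop, noise,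
    Measure.map_map (by fun_prop) (by fun_prop), Measure.map_map (by fun_prop) (by fun_prop)]
  rfl

lemma noise_map_const_add (hσ : σ ≠ 0) (a : Euc ℓ) :
    (noise ℓ σ).map (a + ·) =
      (noise ℓ σ).withDensity fun y => ENNReal.ofReal (Real.exp (logRatio σ a y)) := by
  have hmeas : Measurable fun y => ENNReal.ofReal (Real.exp (logRatio σ a y)) := by fun_prop
  rw [noise_map_const_add_eq_map_pi, pi_gaussianReal_eq_withDensity hσ, noise,
    ← map_withDensity_comp _ (by fun_prop) hmeas]
  rfl

lemma lintegral_noise_const_add (hσ : σ ≠ 0) (a : Euc ℓ) {F : Euc ℓ → ℝ≥0∞} (hF : Measurable F) :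
    ∫⁻ z, F (a + z) ∂(noise ℓ σ) =
      ∫⁻ y, ENNReal.ofReal (Real.exp (logRatio σ a y)) * F y ∂(noise ℓ σ) := by
  have hmeas : Measurable fun y => ENNReal.ofReal (Real.exp (logRatio σ a y)) := by fun_prop
  rw [← lintegral_map (g := (a + ·)) hF (by fun_prop), noise_map_const_add hσ,
    lintegral_withDensity_eq_lintegral_mul _ hmeas hF]
  rfl

variable {Ω : Type*} [MeasurableSpace Ω] {κ : Measure Ω} {a : Ω → Euc ℓ}

lemma map_prod_noise_add (hσ : σ ≠ 0) (ha : Measurable a) :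
    (κ.prod (noise ℓ σ)).map (fun o => (o.1, a o.1 + o.2)) =
      (κ.prod (noise ℓ σ)).withDensity
        fun o => ENNReal.ofReal (Real.exp (logRatio σ (a o.1) o.2)) := by
  refine Measure.ext_of_lintegral _ fun F hF => ?_
  have hshift : Measurable fun o : Ω × Euc ℓ => (o.1, a o.1 + o.2) := by fun_prop
  have hFshift : Measurable fun o : Ω × Euc ℓ => F (o.1, a o.1 + o.2) := hF.comp hshift
  have hmeas : Measurable fun o : Ω × Euc ℓ =>
      ENNReal.ofReal (Real.exp (logRatio σ (a o.1) o.2)) := by fun_prop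
  rw [lintegral_map hF hshift, lintegral_withDensity_eq_lintegral_mul _ hmeas hF,
    lintegral_prod _ hFshift.aemeasurable, lintegral_prod _ (hmeas.mul hF).aemeasurable]
  exact lintegral_congr fun u =>
    lintegral_noise_const_add hσ (a u) (hF.comp measurable_prodMk_left)

lemma logRatio_add_self (a z : Euc ℓ) :
    logRatio σ a (a + z) = (inner ℝ a z + ‖a‖ ^ 2 / 2) / σ ^ 2 := by
  rw [logRatio, inner_add_right, real_inner_self_eq_norm_sq]
  ring

variable [IsProbabilityMeasure κ]

lemma integrable_logRatio_add (ha : MemLp a 2 κ) :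
    Integrable (fun o : Ω × Euc ℓ => logRatio σ (a o.1) (a o.1 + o.2)) (κ.prod (noise ℓ σ)) := by
  simp_rw [logRatio_add_self]
  exact ((integrable_inner_prod ha (memLp_two_noise ℓ σ)).add
    (((ha.comp_fst _).integrable_norm_pow two_ne_zero).div_const 2)).div_const _

lemma integral_logRatio_add (ha : MemLp a 2 κ) :
    ∫ o, logRatio σ (a o.1) (a o.1 + o.2) ∂(κ.prod (noise ℓ σ)) =
      (∫ u, ‖a u‖ ^ 2 ∂κ) / (2 * σ ^ 2) := by
  simp_rw [logRatio_add_self]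
  rw [integral_div, integral_add (integrable_inner_prod ha (memLp_two_noise ℓ σ))
      (((ha.comp_fst _).integrable_norm_pow two_ne_zero).div_const 2),
    integral_inner_prod_eq_zero ha (memLp_two_noise ℓ σ) (integral_id_noise ℓ σ), integral_div]
  simp [div_div, integral_fun_fst (μ := κ) (ν := noise ℓ σ) (fun u => ‖a u‖ ^ 2)]

lemma integrable_exp_mul_logRatio (hσ : σ ≠ 0) (ha : Measurable a) (ha2 : MemLp a 2 κ) :
    Integrable (fun o : Ω × Euc ℓ =>
      Real.exp (logRatio σ (a o.1) o.2) * logRatio σ (a o.1) o.2) (κ.prod (noise ℓ σ)) := by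
  have hmeas : Measurable fun o : Ω × Euc ℓ => logRatio σ (a o.1) o.2 := by
    fun_prop
  have hshift : Measurable fun o : Ω × Euc ℓ => (o.1, a o.1 + o.2) := by fun_prop
  have hint : Integrable (fun o : Ω × Euc ℓ => logRatio σ (a o.1) o.2)
      ((κ.prod (noise ℓ σ)).map fun o => (o.1, a o.1 + o.2)) :=
    (integrable_map_measure hmeas.aestronglyMeasurable hshift.aemeasurable).2
      (integrable_logRatio_add ha2)
  rw [map_prod_noise_add hσ ha, integrable_withDensity_iff_integrable_smul₀'
    hmeas.exp.ennreal_ofReal.aemeasurable (by simp)] at hint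
  simpa only [ENNReal.toReal_ofReal (Real.exp_pos _).le, smul_eq_mul] using hint

lemma integral_exp_mul_logRatio (hσ : σ ≠ 0) (ha : Measurable a) (ha2 : MemLp a 2 κ) :
    ∫ o, Real.exp (logRatio σ (a o.1) o.2) * logRatio σ (a o.1) o.2 ∂(κ.prod (noise ℓ σ)) =
      (∫ u, ‖a u‖ ^ 2 ∂κ) / (2 * σ ^ 2) := by
  have hmeas : Measurable fun o : Ω × Euc ℓ => logRatio σ (a o.1) o.2 := by
    fun_prop
  have hshift : Measurable fun o : Ω × Euc ℓ => (o.1, a o.1 + o.2) := by fun_prop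
  have hdensity := integral_withDensity_eq_integral_toReal_smul (μ := κ.prod (noise ℓ σ))
    hmeas.exp.ennreal_ofReal (by simp) fun o => logRatio σ (a o.1) o.2
  simp only [ENNReal.toReal_ofReal (Real.exp_pos _).le, smul_eq_mul] at hdensity
  rw [← hdensity, ← map_prod_noise_add hσ ha,
    integral_map hshift.aemeasurable hmeas.aestronglyMeasurable]
  exact integral_logRatio_add ha2

end GaussianShift

section ChiSquare

variable {Ω : Type*} [MeasurableSpace Ω]

lemma integral_abs_le_sqrt_integral_sq {M : Measure Ω} [IsProbabilityMeasure M] {Y : Ω → ℝ}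
    (hY : MemLp Y 2 M) : ∫ x, |Y x| ∂M ≤ √(∫ x, Y x ^ 2 ∂M) := by
  have hvar := variance_nonneg |Y| M
  rw [variance_eq_sub hY.abs] at hvar
  simp only [Pi.pow_apply, Pi.abs_apply, sq_abs] at hvar
  exact Real.le_sqrt_of_sq_le (by linarith)

lemma integral_sub_one_sq {M : Measure Ω} [IsProbabilityMeasure M] {L : Ω → ℝ}
    (hL : MemLp L 2 M) (hL1 : ∫ x, L x ∂M = 1) :
    ∫ x, (L x - 1) ^ 2 ∂M = ∫ x, L x ^ 2 ∂M - 1 := by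
  have hvar := variance_eq_sub hL
  rw [variance_eq_integral hL.aemeasurable, hL1] at hvar
  simpa using hvar

lemma abs_integral_withDensity_sub_le {M : Measure Ω} [IsProbabilityMeasure M] {L : Ω → ℝ}
    (hLm : Measurable L) (hL0 : ∀ x, 0 ≤ L x) (hL : MemLp L 2 M) (hL1 : ∫ x, L x ∂M = 1)
    {F : Ω → ℝ} (hF : Measurable F) {b : ℝ} (hb : ∀ x, |F x| ≤ b) :
    |∫ x, F x ∂(M.withDensity fun x => ENNReal.ofReal (L x)) - ∫ x, F x ∂M| ≤
      b * √(∫ x, L x ^ 2 ∂M - 1) := by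
  have hLF : Integrable (fun x => L x * F x) M :=
    (hL.integrable one_le_two).mul_bdd hF.aestronglyMeasurable (ae_of_all _ hb)
  have hFi : Integrable F M := .of_bound hF.aestronglyMeasurable b (ae_of_all _ hb)
  have hY : MemLp (fun x => L x - 1) 2 M := hL.sub (memLp_const 1)
  have hdensity : ∫ x, F x ∂(M.withDensity fun x => ENNReal.ofReal (L x)) =
      ∫ x, L x * F x ∂M := by
    rw [integral_withDensity_eq_integral_toReal_smul hLm.ennreal_ofReal (by simp)]
    simp only [ENNReal.toReal_ofReal (hL0 _), smul_eq_mul]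
  have hb0 : 0 ≤ b := by
    obtain ⟨x⟩ := nonempty_of_isProbabilityMeasure M
    exact (abs_nonneg _).trans (hb x)
  calc |∫ x, F x ∂(M.withDensity fun x => ENNReal.ofReal (L x)) - ∫ x, F x ∂M|
      = |∫ x, (L x - 1) * F x ∂M| := by
        rw [hdensity, ← integral_sub hLF hFi]
        simp only [sub_mul, one_mul]
    _ ≤ ∫ x, b * |L x - 1| ∂M := by
        refine norm_integral_le_of_norm_le (G := ℝ) ((hY.integrable one_le_two).abs.const_mul b)
          (ae_of_all _ fun x => ?_)
        rw [Real.norm_eq_abs, abs_mul, mul_comm]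
        exact mul_le_mul_of_nonneg_right (hb x) (abs_nonneg _)
    _ ≤ b * √(∫ x, L x ^ 2 ∂M - 1) := by
        rw [integral_const_mul, ← integral_sub_one_sq hL hL1]
        exact mul_le_mul_of_nonneg_left (integral_abs_le_sqrt_integral_sq hY) hb0

variable {W : Type*} [MeasurableSpace W] (ρ : Measure W)
  {Q : Measure Ω} [IsProbabilityMeasure Q] {L : Ω → ℝ} {t : ℕ}

lemma prod_pi_withDensity (hLm : Measurable L) (hL0 : ∀ x, 0 ≤ L x)
    [SigmaFinite (Q.withDensity fun x => ENNReal.ofReal (L x))] :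
    ρ.prod (Measure.pi fun _ : Fin t => Q.withDensity fun x => ENNReal.ofReal (L x)) =
      (ρ.prod (Measure.pi fun _ : Fin t => Q)).withDensity
        fun h => ENNReal.ofReal (∏ j, L (h.2 j)) := by
  rw [pi_withDensity (fun _ => Q) fun _ => hLm.ennreal_ofReal,
    prod_withDensity_right (by fun_prop)]
  simp only [ENNReal.ofReal_prod_of_nonneg fun _ _ => hL0 _]

variable [IsProbabilityMeasure ρ]

lemma integrable_prod_pi (hL : Integrable L Q) :
    Integrable (fun h : W × (Fin t → Ω) => ∏ j, L (h.2 j))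
      (ρ.prod (Measure.pi fun _ : Fin t => Q)) :=
  (Integrable.fintype_prod (f := fun _ => L) fun _ => hL).comp_snd ρ

lemma integral_prod_pi (L : Ω → ℝ) :
    ∫ h, ∏ j, L (h.2 j) ∂(ρ.prod (Measure.pi fun _ : Fin t => Q)) = (∫ x, L x ∂Q) ^ t := by
  rw [integral_fun_snd (μ := ρ) (fun o : Fin t → Ω => ∏ j, L (o j)),
    integral_fintype_prod_eq_pow]
  simp

lemma abs_integral_prod_pi_sub_le (hLm : Measurable L) (hL0 : ∀ x, 0 ≤ L x) (hL : MemLp L 2 Q)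
    (hL1 : ∫ x, L x ∂Q = 1) {F : W × (Fin t → Ω) → ℝ} (hF : Measurable F) {b : ℝ}
    (hb : ∀ h, |F h| ≤ b) [SigmaFinite (Q.withDensity fun x => ENNReal.ofReal (L x))] :
    |∫ h, F h ∂(ρ.prod (Measure.pi fun _ => Q.withDensity fun x => ENNReal.ofReal (L x))) -
        ∫ h, F h ∂(ρ.prod (Measure.pi fun _ => Q))| ≤ b * √((∫ x, L x ^ 2 ∂Q) ^ t - 1) := by
  have hmeas : Measurable fun h : W × (Fin t → Ω) => ∏ j, L (h.2 j) := by fun_prop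
  have hmem : MemLp (fun h : W × (Fin t → Ω) => ∏ j, L (h.2 j)) 2
      (ρ.prod (Measure.pi fun _ : Fin t => Q)) := by
    rw [memLp_two_iff_integrable_sq hmeas.aestronglyMeasurable]
    simp_rw [← Finset.prod_pow]
    exact integrable_prod_pi ρ hL.integrable_sq
  have hbound := abs_integral_withDensity_sub_le hmeas (fun h => Finset.prod_nonneg fun _ _ =>
    hL0 _) hmem (by rw [integral_prod_pi, hL1, one_pow]) hF hb
  simp_rw [← Finset.prod_pow] at hbound
  rwa [integral_prod_pi ρ (fun x => L x ^ 2), ← prod_pi_withDensity ρ hLm hL0] at hbound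

end ChiSquare

section ConstantOracle

variable {d ℓ T : ℕ} {B P : ℝ} {X : Set (Euc d)} {c : Code d ℓ B P} {σ : ℝ}

lemma lintegral_pi_snoc {Ω : Type*} [MeasurableSpace Ω] (Q : Measure Ω) [SigmaFinite Q] {t : ℕ}
    {F : (Fin (t + 1) → Ω) → ℝ≥0∞} (hF : Measurable F) :
    ∫⁻ h, F h ∂(Measure.pi fun _ => Q) =
      ∫⁻ h, ∫⁻ o, F (Fin.snoc (α := fun _ => Ω) h o) ∂Q ∂(Measure.pi fun _ : Fin t => Q) := by
  have hpres := (measurePreserving_piFinSuccAbove (fun _ : Fin (t + 1) => Q) (Fin.last t)).symm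
  have hsymm : ∀ p : Ω × (Fin t → Ω),
      (MeasurableEquiv.piFinSuccAbove (fun _ : Fin (t + 1) => Ω) (Fin.last t)).symm p =
        Fin.snoc (α := fun _ => Ω) p.2 p.1 := fun p => by
    rw [MeasurableEquiv.piFinSuccAbove_symm_apply]
    exact Fin.insertNth_last' p.1 p.2
  rw [← hpres.lintegral_comp hF, lintegral_prod_symm _ (by fun_prop)]
  simp only [hsymm]

lemma transcript_eq_prod_pi (π : Algorithm X c T) (O : Kernel X (Euc d)) [IsMarkovKernel O]
    {Q : Measure (Obs c)} [SigmaFinite Q] (hO : ∀ x, observe c σ O x = Q) (t : ℕ) :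
    transcript σ π O t = π.lawW.prod (Measure.pi fun _ : Fin t => Q) := by
  induction t with
  | zero =>
    rw [Measure.pi_of_empty _ Fin.elim0, Measure.prod_dirac]
    rfl
  | succ t ih =>
    refine Measure.ext_of_lintegral _ fun F hF => ?_
    have hsnoc : Measurable fun q : (π.W × (Fin t → Obs c)) × Obs c =>
        F (q.1.1, Fin.snoc (α := fun _ => Obs c) q.1.2 q.2) := hF.comp measurable_snoc
    rw [lintegral_transcript_succ π O t hF, ih, lintegral_prod _ hF.aemeasurable]
    simp only [hO]
    rw [lintegral_prod _ hsnoc.lintegral_prod_right'.aemeasurable]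
    exact lintegral_congr fun w =>
      (lintegral_pi_snoc Q (hF.comp measurable_prodMk_left)).symm

end ConstantOracle

section Information

open InformationTheory

variable {S : Type*} [MeasurableSpace S] {μ ν : Measure S} [IsProbabilityMeasure ν]

lemma integral_le_toReal_klDiv_add_log [IsProbabilityMeasure μ] (hμν : μ ≪ ν)
    (hllr : Integrable (llr μ ν) μ) {F : S → ℝ} (hF : Integrable F μ)
    (hexp : Integrable (fun s => Real.exp (F s)) ν) :
    ∫ s, F s ∂μ ≤ (klDiv μ ν).toReal + Real.log (∫ s, Real.exp (F s) ∂ν) := by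
  have := isProbabilityMeasure_tilted hexp
  have hnonneg := integral_llr_add_sub_measure_univ_nonneg
    (hμν.trans (absolutelyContinuous_tilted hexp)) (integrable_llr_tilted_right hμν hF hllr hexp)
  rw [integral_llr_tilted_right hμν hF hexp hllr, ← toReal_klDiv_of_measure_eq hμν (by simp)]
    at hnonneg
  simp only [probReal_univ] at hnonneg
  linarith

lemma sum_sq_integral_le_klDiv [IsProbabilityMeasure μ] (hμν : μ ≪ ν)
    (hllr : Integrable (llr μ ν) μ) {ι : Type*} [Fintype ι] {X : ι → S → ℝ} {c : NNReal}
    (hindep : iIndepFun X ν) (hsub : ∀ i, HasSubgaussianMGF (X i) c ν)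
    (hX : ∀ i, Integrable (X i) μ) :
    ∑ i, (∫ s, X i s ∂μ) ^ 2 ≤ 2 * c * (klDiv μ ν).toReal := by
  set b : ι → ℝ := fun i => ∫ s, X i s ∂μ
  have hquad (r : ℝ) : 0 ≤ c * (∑ i, b i ^ 2) / 2 * (r * r) + -(∑ i, b i ^ 2) * r +
      (klDiv μ ν).toReal := by
    have hF : HasSubgaussianMGF (fun s => ∑ i, r * b i * X i s)
        (∑ i, ⟨(r * b i) ^ 2, sq_nonneg _⟩ * c) ν :=
      .sum_of_iIndepFun (hindep.comp (fun i x => r * b i * x) fun i => by fun_prop)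
        fun i _ => (hsub i).const_mul (r * b i)
    have hcgf := hF.cgf_le 1
    have hdv := integral_le_toReal_klDiv_add_log hμν hllr
      (F := fun s => ∑ i, r * b i * X i s)
      (integrable_finsetSum _ fun i _ => (hX i).const_mul (r * b i))
      (by simpa using hF.integrable_exp_mul 1)
    rw [integral_finsetSum _ fun i _ => (hX i).const_mul (r * b i)] at hdv
    simp only [cgf, mgf, one_mul, one_pow, mul_one] at hcgf
    simp only [integral_const_mul] at hdv
    have hlin : ∑ i, r * b i * b i = r * ∑ i, b i ^ 2 := by
      rw [Finset.mul_sum]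
      exact Finset.sum_congr rfl fun i _ => by ring
    have hvar : ((∑ i, ⟨(r * b i) ^ 2, sq_nonneg _⟩ * c : NNReal) : ℝ) =
        r ^ 2 * c * ∑ i, b i ^ 2 := by
      rw [NNReal.coe_sum, Finset.mul_sum]
      refine Finset.sum_congr rfl fun i _ => ?_
      change (r * b i) ^ 2 * (c : ℝ) = _
      ring
    rw [hvar] at hcgf
    have := hdv.trans (add_le_add_right hcgf _)
    rw [show ∑ i, r * b i * ∫ s, X i s ∂μ = r * ∑ i, b i ^ 2 from hlin] at this
    linarith
  have hdiscr := discrim_le_zero hquad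
  rw [discrim] at hdiscr
  rcases (Finset.sum_nonneg fun i _ => sq_nonneg (b i) : 0 ≤ ∑ i, b i ^ 2).eq_or_lt with h0 | h0
  · rw [← h0]
    positivity
  · exact le_of_mul_le_mul_left (by linarith) h0

lemma llr_tilted_self {f : S → ℝ} (hexp : Integrable (fun s => Real.exp (f s)) ν) :
    llr (ν.tilted f) ν =ᵐ[ν.tilted f] fun s => f s - Real.log (∫ s, Real.exp (f s) ∂ν) :=
  (tilted_absolutelyContinuous ν f).ae_le (log_rnDeriv_tilted_left_self hexp)

lemma integrable_llr_tilted_self {f : S → ℝ} (hexp : Integrable (fun s => Real.exp (f s)) ν)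
    (hf : Integrable f (ν.tilted f)) : Integrable (llr (ν.tilted f) ν) (ν.tilted f) := by
  have := isProbabilityMeasure_tilted hexp
  exact (hf.sub (integrable_const _)).congr (llr_tilted_self hexp).symm

lemma toReal_klDiv_tilted_self {f : S → ℝ} (hexp : Integrable (fun s => Real.exp (f s)) ν)
    (hf : Integrable f (ν.tilted f)) :
    (klDiv (ν.tilted f) ν).toReal =
      ∫ s, f s ∂(ν.tilted f) - Real.log (∫ s, Real.exp (f s) ∂ν) := by
  have := isProbabilityMeasure_tilted hexp
  rw [toReal_klDiv_of_measure_eq (tilted_absolutelyContinuous ν f) (by simp),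
    integral_congr_ae (llr_tilted_self hexp), integral_sub hf (integrable_const _)]
  simp

lemma mul_klDiv_tilted_le {f : S → ℝ} (hexp : Integrable (fun s => Real.exp (f s)) ν)
    (hf : Integrable f (ν.tilted f)) :
    (∫ s, Real.exp (f s) ∂ν) * (klDiv (ν.tilted f) ν).toReal ≤
      ∫ s, Real.exp (f s) * f s ∂ν - ∫ s, Real.exp (f s) ∂ν + 1 := by
  set m := ∫ s, Real.exp (f s) ∂ν with hm
  have hm0 : 0 < m := integral_exp_pos hexp
  have hlog : m - 1 ≤ m * Real.log m := by
    have := mul_le_mul_of_nonneg_left (Real.one_sub_inv_le_log_of_pos hm0) hm0.le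
    rwa [mul_sub, mul_one, mul_inv_cancel₀ hm0.ne'] at this
  have hint : m * ∫ s, f s ∂(ν.tilted f) = ∫ s, Real.exp (f s) * f s ∂ν := by
    rw [integral_tilted, ← integral_const_mul]
    refine integral_congr_ae (ae_of_all _ fun s => ?_)
    simp only [← hm, smul_eq_mul]
    field_simp
  rw [toReal_klDiv_tilted_self hexp hf, ← hm, mul_sub, hint]
  linarith

end Information

section Mixture

variable {ℓ : ℕ} {σ : ℝ} {S U : Type*} [MeasurableSpace S] [MeasurableSpace U]

/-- The law of the pair of the public randomness `u ∼ κ` and the Gaussian channel output, when the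
message `s` has law `ν` and is sent as the channel input `a (s, u)`. -/
def channelLaw (σ : ℝ) (κ : Measure U) (a : S × U → Euc ℓ) (ν : Measure S) :
    Measure (U × Euc ℓ) :=
  (ν.prod (κ.prod (noise ℓ σ))).map fun p => (p.2.1, a (p.1, p.2.1) + p.2.2)

/-- The posterior law of the message given the public randomness and the channel output `o`. -/
def posterior (σ : ℝ) (a : S × U → Euc ℓ) (ν : Measure S) (o : U × Euc ℓ) : Measure S :=
  ν.tilted fun s => logRatio σ (a (s, o.1)) o.2

lemma channelLaw_map {R : Type*} [MeasurableSpace R] {κ : Measure U} [SFinite κ]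
    {a : S × U → Euc ℓ} (ha : Measurable a) {φ : R → S} (hφ : Measurable φ) (ν : Measure R)
    [SFinite ν] :
    channelLaw σ κ a (ν.map φ) = channelLaw σ κ (fun p => a (φ p.1, p.2)) ν := by
  have hprod := Measure.map_prod_map ν (κ.prod (noise ℓ σ)) hφ measurable_id
  rw [Measure.map_id] at hprod
  rw [channelLaw, hprod, Measure.map_map (by fun_prop) (by fun_prop)]
  rfl

variable {κ : Measure U} {a : S × U → Euc ℓ} {ν : Measure S}

lemma channelLaw_eq_withDensity_lintegral [SFinite κ] [SFinite ν] (hσ : σ ≠ 0)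
    (ha : Measurable a) :
    channelLaw σ κ a ν = (κ.prod (noise ℓ σ)).withDensity fun o =>
      ∫⁻ s, ENNReal.ofReal (Real.exp (logRatio σ (a (s, o.1)) o.2)) ∂ν := by
  refine Measure.ext_of_lintegral _ fun F hF => ?_
  have hlik : Measurable fun p : (U × Euc ℓ) × S =>
      ENNReal.ofReal (Real.exp (logRatio σ (a (p.2, p.1.1)) p.1.2)) := by fun_prop
  have hout : Measurable fun p : S × U × Euc ℓ => (p.2.1, a (p.1, p.2.1) + p.2.2) := by fun_prop
  have hFout : Measurable fun p : S × U × Euc ℓ => F (p.2.1, a (p.1, p.2.1) + p.2.2) :=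
    hF.comp hout
  calc ∫⁻ o, F o ∂(channelLaw σ κ a ν)
      = ∫⁻ s, ∫⁻ o, F (o.1, a (s, o.1) + o.2) ∂(κ.prod (noise ℓ σ)) ∂ν := by
        rw [channelLaw, lintegral_map hF hout, lintegral_prod _ hFout.aemeasurable]
    _ = ∫⁻ s, ∫⁻ o, ENNReal.ofReal (Real.exp (logRatio σ (a (s, o.1)) o.2)) * F o
          ∂(κ.prod (noise ℓ σ)) ∂ν := by
        refine lintegral_congr fun s => ?_
        have has : Measurable fun u => a (s, u) := by fun_prop
        rw [← lintegral_map (g := fun o : U × Euc ℓ => (o.1, a (s, o.1) + o.2)) hF (by fun_prop),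
          map_prod_noise_add hσ has, lintegral_withDensity_eq_lintegral_mul _ (by fun_prop) hF]
        rfl
    _ = ∫⁻ o, (∫⁻ s, ENNReal.ofReal (Real.exp (logRatio σ (a (s, o.1)) o.2)) ∂ν) * F o
          ∂(κ.prod (noise ℓ σ)) := by
        rw [lintegral_lintegral_swap (by fun_prop)]
        refine lintegral_congr fun o => ?_
        rw [lintegral_mul_const _ (by fun_prop)]
    _ = _ := by
        rw [lintegral_withDensity_eq_lintegral_mul _ hlik.lintegral_prod_right' hF]
        rfl

lemma logRatio_le (a y : Euc ℓ) : logRatio σ a y ≤ ‖y‖ ^ 2 / 2 / σ ^ 2 := by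
  have hinner := real_inner_le_norm a y
  rw [logRatio]
  gcongr
  linarith [two_mul_le_add_sq ‖a‖ ‖y‖]

lemma integrable_exp_logRatio [IsFiniteMeasure ν] (ha : Measurable a) (o : U × Euc ℓ) :
    Integrable (fun s => Real.exp (logRatio σ (a (s, o.1)) o.2)) ν :=
  .of_bound (by fun_prop : Measurable fun s =>
      Real.exp (logRatio σ (a (s, o.1)) o.2)).aestronglyMeasurable
    (Real.exp (‖o.2‖ ^ 2 / 2 / σ ^ 2)) (ae_of_all _ fun s => by
      rw [Real.norm_eq_abs, Real.abs_exp]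
      exact Real.exp_le_exp.2 (logRatio_le _ _))

lemma isProbabilityMeasure_posterior [IsProbabilityMeasure ν] (ha : Measurable a)
    (o : U × Euc ℓ) : IsProbabilityMeasure (posterior σ a ν o) :=
  isProbabilityMeasure_tilted (integrable_exp_logRatio ha o)

lemma channelLaw_eq_withDensity [SFinite κ] [IsFiniteMeasure ν] (hσ : σ ≠ 0)
    (ha : Measurable a) :
    channelLaw σ κ a ν = (κ.prod (noise ℓ σ)).withDensity fun o =>
      ENNReal.ofReal (∫ s, Real.exp (logRatio σ (a (s, o.1)) o.2) ∂ν) := by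
  rw [channelLaw_eq_withDensity_lintegral hσ ha]
  congr 1 with o
  exact (ofReal_integral_eq_lintegral_ofReal (integrable_exp_logRatio ha o)
    (ae_of_all _ fun _ => (Real.exp_pos _).le)).symm

end Mixture

section Posterior

open InformationTheory

variable {ℓ : ℕ} {σ : ℝ} {S U : Type*} [MeasurableSpace S] [MeasurableSpace U] {κ : Measure U}
  {a : S × U → Euc ℓ} {ν : Measure S}

lemma isProbabilityMeasure_channelLaw [IsProbabilityMeasure κ] [IsProbabilityMeasure ν]
    (ha : Measurable a) : IsProbabilityMeasure (channelLaw σ κ a ν) :=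
  Measure.isProbabilityMeasure_map (by fun_prop)

lemma measurable_integral_exp_logRatio [SFinite ν] (ha : Measurable a) :
    Measurable fun o : U × Euc ℓ => ∫ s, Real.exp (logRatio σ (a (s, o.1)) o.2) ∂ν :=
  (by fun_prop : Measurable fun p : (U × Euc ℓ) × S =>
    Real.exp (logRatio σ (a (p.2, p.1.1)) p.1.2)).stronglyMeasurable.integral_prod_right'.measurable

lemma measurable_posterior [SFinite ν] (ha : Measurable a) : Measurable (posterior σ a ν) := by
  refine Measure.measurable_of_measurable_coe _ fun t ht => ?_
  simp only [posterior, tilted_apply' _ _ ht]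
  have hm := measurable_integral_exp_logRatio (σ := σ) (ν := ν) ha
  have hlik : Measurable fun p : (U × Euc ℓ) × S =>
      Real.exp (logRatio σ (a (p.2, p.1.1)) p.1.2) := by fun_prop
  exact (hlik.div (hm.comp measurable_fst)).ennreal_ofReal.lintegral_prod_right'

lemma measurable_integral_posterior [IsProbabilityMeasure ν] (ha : Measurable a) {X : S → ℝ}
    (hX : Measurable X) : Measurable fun o => ∫ s, X s ∂(posterior σ a ν o) := by
  have : IsMarkovKernel (⟨posterior σ a ν, measurable_posterior ha⟩ : Kernel (U × Euc ℓ) S) :=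
    ⟨isProbabilityMeasure_posterior ha⟩
  exact (hX.stronglyMeasurable.integral_kernel
    (κ := ⟨posterior σ a ν, measurable_posterior ha⟩)).measurable

lemma channelLaw_withDensity [SFinite κ] [IsProbabilityMeasure ν] (hσ : σ ≠ 0) (ha : Measurable a)
    {g : S → ℝ≥0∞} (hg : Measurable g) :
    channelLaw σ κ a (ν.withDensity g) =
      (channelLaw σ κ a ν).withDensity fun o => ∫⁻ s, g s ∂(posterior σ a ν o) := by
  have hm := measurable_integral_exp_logRatio (σ := σ) (ν := ν) ha
  have hpost : Measurable fun o => ∫⁻ s, g s ∂(posterior σ a ν o) :=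
    (Measure.measurable_lintegral hg).comp (measurable_posterior ha)
  rw [channelLaw_eq_withDensity_lintegral hσ ha, channelLaw_eq_withDensity hσ ha,
    ← withDensity_mul _ hm.ennreal_ofReal hpost]
  congr 1 with o
  have hlik : Measurable fun s => Real.exp (logRatio σ (a (s, o.1)) o.2) := by fun_prop
  rw [Pi.mul_apply, posterior, lintegral_tilted, ← lintegral_const_mul _ (by fun_prop),
    lintegral_withDensity_eq_lintegral_mul _ hg hlik.ennreal_ofReal]
  refine lintegral_congr fun s => ?_
  have hpos := integral_exp_pos (integrable_exp_logRatio (σ := σ) (ν := ν) ha o)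
  simp only [Pi.mul_apply]
  rw [← mul_assoc, ← ENNReal.ofReal_mul hpos.le, mul_div_cancel₀ _ hpos.ne', mul_comm]

lemma integrable_posterior [IsFiniteMeasure ν] (ha : Measurable a) (o : U × Euc ℓ) {X : S → ℝ}
    (hX : Integrable X ν) : Integrable X (posterior σ a ν o) := by
  have hexp := integrable_exp_logRatio (σ := σ) (ν := ν) ha o
  refine (integrable_tilted_iff hexp X).2 ?_
  exact hX.bdd_mul hexp.aestronglyMeasurable (c := Real.exp (‖o.2‖ ^ 2 / 2 / σ ^ 2))
    (ae_of_all _ fun s => by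
      rw [Real.norm_eq_abs, Real.abs_exp]
      exact Real.exp_le_exp.2 (logRatio_le _ _))

lemma channelLaw_withDensity_one_add [IsProbabilityMeasure κ] [IsProbabilityMeasure ν] (hσ : σ ≠ 0)
    (ha : Measurable a) {X : S → ℝ} (hX : Measurable X) (hXi : Integrable X ν)
    (hX0 : ∀ s, 0 ≤ 1 + X s) :
    channelLaw σ κ a (ν.withDensity fun s => ENNReal.ofReal (1 + X s)) =
      (channelLaw σ κ a ν).withDensity fun o =>
        ENNReal.ofReal (1 + ∫ s, X s ∂(posterior σ a ν o)) := by
  rw [channelLaw_withDensity hσ ha (by fun_prop)]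
  congr 1 with o
  have := isProbabilityMeasure_posterior (σ := σ) (ν := ν) ha o
  have hint := integrable_posterior (σ := σ) ha o hXi
  have hone : Integrable (fun s => 1 + X s) (posterior σ a ν o) := (integrable_const 1).add hint
  rw [← ofReal_integral_eq_lintegral_ofReal hone (ae_of_all _ hX0),
    integral_add (integrable_const 1) hint]
  simp

lemma exp_mul_abs_le (x : ℝ) : Real.exp x * |x| ≤ 1 + Real.exp x ^ 2 := by
  rcases le_total 0 x with hx | hx
  · have hle : x ≤ Real.exp x := by linarith [Real.add_one_le_exp x]
    rw [abs_of_nonneg hx, sq]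
    linarith [mul_le_mul_of_nonneg_left hle (Real.exp_pos x).le]
  · have hle : -x ≤ Real.exp (-x) := by linarith [Real.add_one_le_exp (-x)]
    have hmul := mul_le_mul_of_nonneg_left hle (Real.exp_pos x).le
    rw [← Real.exp_add, add_neg_cancel, Real.exp_zero] at hmul
    rw [abs_of_nonpos hx]
    linarith [sq_nonneg (Real.exp x)]

lemma integrable_logRatio_posterior [IsFiniteMeasure ν] (ha : Measurable a) (o : U × Euc ℓ) :
    Integrable (fun s => logRatio σ (a (s, o.1)) o.2) (posterior σ a ν o) := by
  refine (integrable_tilted_iff (integrable_exp_logRatio ha o) _).2 ?_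
  refine .of_bound (by fun_prop : Measurable fun s =>
      Real.exp (logRatio σ (a (s, o.1)) o.2) • logRatio σ (a (s, o.1)) o.2).aestronglyMeasurable
    (1 + Real.exp (‖o.2‖ ^ 2 / 2 / σ ^ 2) ^ 2) (ae_of_all _ fun s => ?_)
  rw [norm_smul, Real.norm_eq_abs, Real.abs_exp, Real.norm_eq_abs]
  refine (exp_mul_abs_le _).trans ?_
  gcongr
  exact logRatio_le _ _

lemma lintegral_channelLaw [SFinite κ] [IsFiniteMeasure ν] (hσ : σ ≠ 0) (ha : Measurable a)
    (F : U × Euc ℓ → ℝ≥0∞) :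
    ∫⁻ o, F o ∂(channelLaw σ κ a ν) =
      ∫⁻ o, ENNReal.ofReal (∫ s, Real.exp (logRatio σ (a (s, o.1)) o.2) ∂ν) * F o
        ∂(κ.prod (noise ℓ σ)) := by
  have hm := (measurable_integral_exp_logRatio (σ := σ) (ν := ν) ha).ennreal_ofReal
  rw [channelLaw_eq_withDensity hσ ha,
    lintegral_withDensity_eq_lintegral_mul_non_measurable _ hm (by simp)]
  rfl

variable [IsProbabilityMeasure κ] [IsProbabilityMeasure ν]

lemma integrable_integral_exp_logRatio (hσ : σ ≠ 0) (ha : Measurable a) :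
    Integrable (fun o => ∫ s, Real.exp (logRatio σ (a (s, o.1)) o.2) ∂ν) (κ.prod (noise ℓ σ)) ∧
      ∫ o, ∫ s, Real.exp (logRatio σ (a (s, o.1)) o.2) ∂ν ∂(κ.prod (noise ℓ σ)) = 1 := by
  have hm := measurable_integral_exp_logRatio (σ := σ) (ν := ν) ha
  have := isProbabilityMeasure_channelLaw (σ := σ) (κ := κ) (ν := ν) ha
  have hmass := lintegral_channelLaw (κ := κ) (ν := ν) hσ ha fun _ => 1
  simp only [lintegral_one, measure_univ, mul_one] at hmass
  have hnonneg (o : U × Euc ℓ) : 0 ≤ ∫ s, Real.exp (logRatio σ (a (s, o.1)) o.2) ∂ν :=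
    integral_nonneg fun _ => (Real.exp_pos _).le
  refine ⟨⟨hm.aestronglyMeasurable, ?_⟩, ?_⟩
  · rw [hasFiniteIntegral_iff_ofReal (ae_of_all _ hnonneg), ← hmass]
    exact ENNReal.one_lt_top
  · rw [integral_eq_lintegral_of_nonneg_ae (ae_of_all _ hnonneg) hm.aestronglyMeasurable, ← hmass,
      ENNReal.toReal_one]

lemma integrable_integral_exp_mul_logRatio (hσ : σ ≠ 0) (ha : Measurable a)
    (ha2 : MemLp a 2 (ν.prod κ)) :
    Integrable (fun o => ∫ s, Real.exp (logRatio σ (a (s, o.1)) o.2) *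
        logRatio σ (a (s, o.1)) o.2 ∂ν) (κ.prod (noise ℓ σ)) ∧
      ∫ o, ∫ s, Real.exp (logRatio σ (a (s, o.1)) o.2) * logRatio σ (a (s, o.1)) o.2 ∂ν
        ∂(κ.prod (noise ℓ σ)) = (∫ p, ‖a p‖ ^ 2 ∂(ν.prod κ)) / (2 * σ ^ 2) := by
  have hassoc := measurePreserving_prodAssoc ν κ (noise ℓ σ)
  have hint : Integrable (fun q : S × U × Euc ℓ =>
      Real.exp (logRatio σ (a (q.1, q.2.1)) q.2.2) * logRatio σ (a (q.1, q.2.1)) q.2.2)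
      (ν.prod (κ.prod (noise ℓ σ))) :=
    (hassoc.integrable_comp_emb MeasurableEquiv.prodAssoc.measurableEmbedding).1
      (integrable_exp_mul_logRatio hσ ha ha2)
  refine ⟨hint.integral_prod_right, ?_⟩
  rw [← integral_prod_symm _ hint, ← integral_exp_mul_logRatio hσ ha ha2]
  exact (hassoc.integral_comp MeasurableEquiv.prodAssoc.measurableEmbedding _).symm

lemma lintegral_klDiv_posterior_le (hσ : σ ≠ 0) (ha : Measurable a)
    (ha2 : MemLp a 2 (ν.prod κ)) :
    ∫⁻ o, klDiv (posterior σ a ν o) ν ∂(channelLaw σ κ a ν) ≤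
      ENNReal.ofReal ((∫ p, ‖a p‖ ^ 2 ∂(ν.prod κ)) / (2 * σ ^ 2)) := by
  obtain ⟨hm, hm1⟩ := integrable_integral_exp_logRatio (κ := κ) (ν := ν) hσ ha
  obtain ⟨hf, hf1⟩ := integrable_integral_exp_mul_logRatio hσ ha ha2
  have hm0 (o : U × Euc ℓ) := integral_exp_pos (integrable_exp_logRatio (σ := σ) (ν := ν) ha o)
  have hbound (o : U × Euc ℓ) :=
    mul_klDiv_tilted_le (integrable_exp_logRatio (σ := σ) (ν := ν) ha o)
      (integrable_logRatio_posterior ha o)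
  have hint := (hf.sub hm).add (integrable_const 1)
  have hvalue := integral_add' (hf.sub hm) (integrable_const 1)
  rw [integral_sub' hf hm, hf1, hm1] at hvalue
  simp only [integral_const, probReal_univ, one_smul, sub_add_cancel] at hvalue
  rw [lintegral_channelLaw hσ ha, ← hvalue,
    ofReal_integral_eq_lintegral_ofReal hint (ae_of_all _ fun o =>
      (mul_nonneg (hm0 o).le ENNReal.toReal_nonneg).trans (hbound o))]
  refine lintegral_mono fun o => ?_
  have hfin : klDiv (posterior σ a ν o) ν ≠ ∞ :=
    klDiv_ne_top (tilted_absolutelyContinuous _ _)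
      (integrable_llr_tilted_self (integrable_exp_logRatio ha o)
        (integrable_logRatio_posterior ha o))
  rw [← ENNReal.ofReal_toReal hfin, ← ENNReal.ofReal_mul (hm0 o).le]
  exact ENNReal.ofReal_le_ofReal (hbound o)

lemma sum_lintegral_sq_integral_posterior_le (hσ : σ ≠ 0) (ha : Measurable a)
    (ha2 : MemLp a 2 (ν.prod κ)) {ι : Type*} [Fintype ι] {X : ι → S → ℝ} {c : NNReal}
    (hX : ∀ i, Measurable (X i)) (hindep : iIndepFun X ν)
    (hsub : ∀ i, HasSubgaussianMGF (X i) c ν) :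
    ∑ i, ∫⁻ o, ENNReal.ofReal ((∫ s, X i s ∂(posterior σ a ν o)) ^ 2) ∂(channelLaw σ κ a ν) ≤
      ENNReal.ofReal (c * (∫ p, ‖a p‖ ^ 2 ∂(ν.prod κ)) / σ ^ 2) := by
  have hpointwise (o : U × Euc ℓ) : ∑ i, (∫ s, X i s ∂(posterior σ a ν o)) ^ 2 ≤
      2 * c * (klDiv (posterior σ a ν o) ν).toReal := by
    have := isProbabilityMeasure_posterior (σ := σ) (ν := ν) ha o
    exact sum_sq_integral_le_klDiv (μ := posterior σ a ν o) (tilted_absolutelyContinuous _ _)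
      (integrable_llr_tilted_self (integrable_exp_logRatio ha o)
        (integrable_logRatio_posterior ha o))
      hindep hsub fun i => integrable_posterior ha o (hsub i).integrable
  calc ∑ i, ∫⁻ o, ENNReal.ofReal ((∫ s, X i s ∂(posterior σ a ν o)) ^ 2) ∂(channelLaw σ κ a ν)
      = ∫⁻ o, ENNReal.ofReal (∑ i, (∫ s, X i s ∂(posterior σ a ν o)) ^ 2)
          ∂(channelLaw σ κ a ν) := by
        rw [← lintegral_finsetSum _ fun i _ =>
          ((measurable_integral_posterior ha (hX i)).pow_const 2).ennreal_ofReal]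
        simp only [ENNReal.ofReal_sum_of_nonneg fun _ _ => sq_nonneg _]
    _ ≤ ∫⁻ o, ENNReal.ofReal (2 * c) * klDiv (posterior σ a ν o) ν ∂(channelLaw σ κ a ν) := by
        refine lintegral_mono fun o => (ENNReal.ofReal_le_ofReal (hpointwise o)).trans ?_
        rw [ENNReal.ofReal_mul (by positivity)]
        gcongr
        exact ENNReal.ofReal_toReal_le
    _ ≤ ENNReal.ofReal (2 * c) *
          ENNReal.ofReal ((∫ p, ‖a p‖ ^ 2 ∂(ν.prod κ)) / (2 * σ ^ 2)) := by
        rw [lintegral_const_mul' _ _ ENNReal.ofReal_ne_top]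
        gcongr
        exact lintegral_klDiv_posterior_le hσ ha ha2
    _ = ENNReal.ofReal (c * (∫ p, ‖a p‖ ^ 2 ∂(ν.prod κ)) / σ ^ 2) := by
        rw [← ENNReal.ofReal_mul (by positivity)]
        congr 1
        field_simp

end Posterior

section SignVectors

variable {d : ℕ}

/-- The sign encoded by a Boolean. -/
def sgn (b : Bool) : ℝ := if b then 1 else -1

lemma sgn_not (b : Bool) : sgn (!b) = -sgn b := by cases b <;> simp [sgn]

lemma sgn_mul_self (b : Bool) : sgn b * sgn b = 1 := by cases b <;> simp [sgn]

lemma abs_sgn (b : Bool) : |sgn b| = 1 := by cases b <;> simp [sgn]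

lemma abs_sgn_mul (b : Bool) (x : ℝ) : |sgn b * x| = |x| := by rw [abs_mul, abs_sgn, one_mul]

/-- The law of a random sign which agrees with `v` with probability `p`. -/
def signLaw (p : unitInterval) (v : Bool) : Measure Bool := bernoulliMeasure v (!v) p

instance (p : unitInterval) (v : Bool) : IsProbabilityMeasure (signLaw p v) := by
  unfold signLaw
  infer_instance

lemma integral_signLaw (p : unitInterval) (v : Bool) (f : Bool → ℝ) :
    ∫ s, f s ∂(signLaw p v) = p * f v + (1 - p) * f (!v) := by
  rw [signLaw, integral_bernoulliMeasure]
  rfl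

lemma integral_sgn_signLaw (p : unitInterval) (v : Bool) :
    ∫ s, sgn s ∂(signLaw p v) = (2 * p - 1) * sgn v := by
  rw [integral_signLaw, sgn_not]
  ring

/-- The relative excess `dν'/dν - 1` of the law `ν'` of a random sign which disagrees with `v` with
probability `p` over the law `ν` of one which agrees with `v` with probability `p`. -/
def flipExcess (p : ℝ) (v s : Bool) : ℝ := if s = v then (1 - p) / p - 1 else p / (1 - p) - 1

lemma one_add_flipExcess_self (p : ℝ) (v : Bool) : 1 + flipExcess p v v = (1 - p) / p := by
  simp [flipExcess]

lemma one_add_flipExcess_not (p : ℝ) (v : Bool) : 1 + flipExcess p v (!v) = p / (1 - p) := by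
  simp [flipExcess]

lemma signLaw_not_eq_withDensity {p : unitInterval} (hp0 : 0 < (p : ℝ)) (hp1 : (p : ℝ) < 1)
    (v : Bool) :
    signLaw p (!v) =
      (signLaw p v).withDensity fun s => ENNReal.ofReal (1 + flipExcess p v s) := by
  have hq : 0 < 1 - (p : ℝ) := sub_pos.2 hp1
  have hcoe (q : unitInterval) (x : ℝ≥0∞) :
      unitInterval.toNNReal q • x = ENNReal.ofReal q * x := by
    rw [ENNReal.smul_def, smul_eq_mul, ENNReal.ofReal_eq_coe_nnreal q.2.1]
    rfl
  refine Measure.ext_of_lintegral _ fun f hf => ?_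
  rw [lintegral_withDensity_eq_lintegral_mul _ (measurable_of_finite _) hf]
  simp only [signLaw, bernoulliMeasure_def, lintegral_add_measure, lintegral_smul_measure,
    lintegral_dirac, Pi.mul_apply, one_add_flipExcess_self, one_add_flipExcess_not, Bool.not_not,
    hcoe, unitInterval.coe_symm_eq, ← mul_assoc, ← ENNReal.ofReal_mul hp0.le,
    ← ENNReal.ofReal_mul hq.le, mul_div_cancel₀ _ hp0.ne', mul_div_cancel₀ _ hq.ne']
  exact add_comm _ _

lemma integral_flipExcess {p : unitInterval} (hp0 : 0 < (p : ℝ)) (hp1 : (p : ℝ) < 1) (v : Bool) :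
    ∫ s, flipExcess p v s ∂(signLaw p v) = 0 := by
  rw [integral_signLaw]
  have := sub_pos.2 hp1
  simp only [flipExcess, ↓reduceIte, Bool.not_eq_self]
  field_simp
  ring

lemma abs_flipExcess_le {p : ℝ} (hp0 : 1 / 2 ≤ p) (hp1 : p ≤ 3 / 4) (v s : Bool) :
    |flipExcess p v s| ≤ 4 * (2 * p - 1) := by
  have hq : 0 < 1 - p := by linarith
  have hp : 0 < p := by linarith
  rw [flipExcess]
  split_ifs
  · rw [abs_le, div_sub_one hp.ne', le_div_iff₀ hp, div_le_iff₀ hp]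
    constructor <;> nlinarith
  · rw [abs_le, div_sub_one hq.ne', le_div_iff₀ hq, div_le_iff₀ hq]
    constructor <;> nlinarith

lemma hasSubgaussianMGF_of_abs_le {Ω : Type*} [MeasurableSpace Ω] {μ : Measure Ω}
    [IsProbabilityMeasure μ] {X : Ω → ℝ} (hm : AEMeasurable X μ) {K : ℝ}
    (hK : ∀ ω, |X ω| ≤ K) (hX : ∫ ω, X ω ∂μ = 0) : HasSubgaussianMGF X (‖K‖₊ ^ 2) μ := by
  have hsub := hasSubgaussianMGF_of_mem_Icc_of_integral_eq_zero hm
    (ae_of_all _ fun ω => abs_le.1 (hK ω)) hX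
  rwa [sub_neg_eq_add, ← two_mul, nnnorm_mul, Real.nnnorm_ofNat, mul_div_cancel_left₀ _ two_ne_zero]
    at hsub

/-- The law of a vector of independent random signs, each agreeing with that of `v` with
probability `p`. -/
def signVecLaw (p : unitInterval) (v : Fin d → Bool) : Measure (Fin d → Bool) :=
  Measure.pi fun i => signLaw p (v i)

instance (p : unitInterval) (v : Fin d → Bool) : IsProbabilityMeasure (signVecLaw p v) := by
  unfold signVecLaw
  infer_instance

lemma integral_eval_signVecLaw (p : unitInterval) (v : Fin d → Bool) (i : Fin d) (f : Bool → ℝ) :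
    ∫ s, f (s i) ∂(signVecLaw p v) = ∫ s, f s ∂(signLaw p (v i)) :=
  integral_comp_eval (μ := fun i => signLaw p (v i)) (by fun_prop)

/-- The sign vector `v` with the sign number `i` reversed. -/
def flipAt (i : Fin d) (v : Fin d → Bool) : Fin d → Bool := Function.update v i (!v i)

lemma flipAt_flipAt (i : Fin d) (v : Fin d → Bool) : flipAt i (flipAt i v) = v := by
  simp [flipAt]

lemma flipAt_apply_self (i : Fin d) (v : Fin d → Bool) : flipAt i v i = !v i := by simp [flipAt]

lemma signVecLaw_flipAt {p : unitInterval} (hp0 : 0 < (p : ℝ)) (hp1 : (p : ℝ) < 1)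
    (v : Fin d → Bool) (i : Fin d) :
    signVecLaw p (flipAt i v) =
      (signVecLaw p v).withDensity fun s => ENNReal.ofReal (1 + flipExcess p (v i) (s i)) := by
  let f : Fin d → Bool → ℝ≥0∞ := fun j s =>
    if j = i then ENNReal.ofReal (1 + flipExcess p (v i) s) else 1
  have hlaw (j : Fin d) : signLaw p (flipAt i v j) = (signLaw p (v j)).withDensity (f j) := by
    by_cases hj : j = i
    · subst hj
      simpa only [f, ↓reduceIte, flipAt_apply_self] using signLaw_not_eq_withDensity hp0 hp1 (v j)
    · simp [f, hj, flipAt]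
  have (j : Fin d) : SigmaFinite ((signLaw p (v j)).withDensity (f j)) :=
    hlaw j ▸ inferInstance
  rw [signVecLaw, funext hlaw, pi_withDensity _ fun j => measurable_of_finite _]
  simp [f, signVecLaw]

lemma hasSubgaussianMGF_flipExcess {p : unitInterval} (hp0 : 1 / 2 ≤ (p : ℝ))
    (hp1 : (p : ℝ) ≤ 3 / 4) (v : Fin d → Bool) (i : Fin d) :
    HasSubgaussianMGF (fun s => flipExcess p (v i) (s i)) (‖4 * (2 * (p : ℝ) - 1)‖₊ ^ 2)
      (signVecLaw p v) :=
  hasSubgaussianMGF_of_abs_le (measurable_of_finite _).aemeasurable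
    (fun s => abs_flipExcess_le hp0 hp1 (v i) (s i)) (by
      rw [integral_eval_signVecLaw, integral_flipExcess (by linarith) (by linarith)])

/-- The vector of norm `B` whose coordinates have the signs `s` and equal absolute values. -/
def gradVec (B : ℝ) (s : Fin d → Bool) : Euc d := WithLp.toLp 2 fun i => B / √d * sgn (s i)

lemma norm_sq_gradVec (hd : 0 < d) (B : ℝ) (s : Fin d → Bool) : ‖gradVec B s‖ ^ 2 = B ^ 2 := by
  have hd' : (0 : ℝ) < d := by exact_mod_cast hd
  have hcoord (i : Fin d) : gradVec B s i ^ 2 = B ^ 2 / d := by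
    rw [gradVec, mul_pow, div_pow, Real.sq_sqrt hd'.le, sq (sgn _), sgn_mul_self, mul_one]
  rw [EuclideanSpace.real_norm_sq_eq]
  simp only [hcoord, Finset.sum_const, Finset.card_univ, Fintype.card_fin, nsmul_eq_mul]
  field_simp

lemma integral_gradVec (B : ℝ) (p : unitInterval) (v : Fin d → Bool) :
    ∫ s, gradVec B s ∂(signVecLaw p v) = (2 * (p : ℝ) - 1) • gradVec B v := by
  ext i
  rw [eval_integral_piLp fun _ => .of_finite]
  simp only [gradVec, PiLp.smul_apply, smul_eq_mul]
  rw [integral_const_mul, integral_eval_signVecLaw p v i sgn, integral_sgn_signLaw]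
  ring

end SignVectors

section TwoPriors

variable {ℓ : ℕ} {σ : ℝ} {S U : Type*} [MeasurableSpace S] [MeasurableSpace U] {κ : Measure U}
  {a : S × U → Euc ℓ} {ν : Measure S} {X : S → ℝ}

/-- The `χ²`-divergence from the channel law with prior `ν` to the one with prior `(1 + X) ν`. By
Bayes' rule the density of the latter is `1 + X̂`, where `X̂` is the posterior mean of `X`. -/
def channelChiSq (σ : ℝ) (κ : Measure U) (a : S × U → Euc ℓ) (ν : Measure S) (X : S → ℝ) : ℝ :=
  ∫ o, (∫ s, X s ∂(posterior σ a ν o)) ^ 2 ∂(channelLaw σ κ a ν)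

lemma channelChiSq_nonneg (σ : ℝ) (κ : Measure U) (a : S × U → Euc ℓ) (ν : Measure S)
    (X : S → ℝ) : 0 ≤ channelChiSq σ κ a ν X :=
  integral_nonneg fun _ => sq_nonneg _

variable [IsProbabilityMeasure ν]

lemma abs_integral_posterior_le (ha : Measurable a) {K : ℝ} (hK : ∀ s, |X s| ≤ K) (o : U × Euc ℓ) :
    |∫ s, X s ∂(posterior σ a ν o)| ≤ K := by
  have := isProbabilityMeasure_posterior (σ := σ) (ν := ν) ha o
  simpa using norm_integral_le_of_norm_le_const (f := X) (μ := posterior σ a ν o) (ae_of_all _ hK)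

variable [IsProbabilityMeasure κ]

lemma memLp_two_integral_posterior (ha : Measurable a) (hX : Measurable X) {K : ℝ}
    (hK : ∀ s, |X s| ≤ K) :
    MemLp (fun o => ∫ s, X s ∂(posterior σ a ν o)) 2 (channelLaw σ κ a ν) :=
  have := isProbabilityMeasure_channelLaw (σ := σ) (κ := κ) (ν := ν) ha
  .of_bound (measurable_integral_posterior ha hX).aestronglyMeasurable K
    (ae_of_all _ (abs_integral_posterior_le ha hK))

lemma sum_channelChiSq_le (hσ : σ ≠ 0) (ha : Measurable a) (ha2 : MemLp a 2 (ν.prod κ))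
    {ι : Type*} [Fintype ι] {X : ι → S → ℝ} {c : NNReal} (hX : ∀ i, Measurable (X i)) {K : ℝ}
    (hK : ∀ i s, |X i s| ≤ K) (hindep : iIndepFun X ν) (hsub : ∀ i, HasSubgaussianMGF (X i) c ν) :
    ∑ i, channelChiSq σ κ a ν (X i) ≤ c * (∫ p, ‖a p‖ ^ 2 ∂(ν.prod κ)) / σ ^ 2 := by
  have : 0 ≤ ∫ p, ‖a p‖ ^ 2 ∂(ν.prod κ) := integral_nonneg fun _ => sq_nonneg _
  rw [← ENNReal.ofReal_le_ofReal_iff (by positivity),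
    ENNReal.ofReal_sum_of_nonneg fun _ _ => channelChiSq_nonneg _ _ _ _ _]
  refine le_of_eq_of_le (Finset.sum_congr rfl fun i _ => ?_)
    (sum_lintegral_sq_integral_posterior_le hσ ha ha2 hX hindep hsub)
  exact ofReal_integral_eq_lintegral_ofReal
    (memLp_two_integral_posterior ha (hX i) (hK i)).integrable_sq (ae_of_all _ fun _ => sq_nonneg _)

lemma abs_integral_prod_pi_channelLaw_sub_le (hσ : σ ≠ 0) (ha : Measurable a) (hX : Measurable X)
    (hX1 : ∀ s, |X s| ≤ 1) {ν' : Measure S} [IsProbabilityMeasure ν']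
    (hν' : ν' = ν.withDensity fun s => ENNReal.ofReal (1 + X s)) {W : Type*} [MeasurableSpace W]
    (ρ : Measure W) [IsProbabilityMeasure ρ] {t : ℕ} {F : W × (Fin t → U × Euc ℓ) → ℝ}
    (hF : Measurable F) {b : ℝ} (hb : ∀ h, |F h| ≤ b) :
    |∫ h, F h ∂(ρ.prod (Measure.pi fun _ => channelLaw σ κ a ν')) -
        ∫ h, F h ∂(ρ.prod (Measure.pi fun _ => channelLaw σ κ a ν))| ≤
      b * √((1 + channelChiSq σ κ a ν X) ^ t - 1) := by
  have := isProbabilityMeasure_channelLaw (σ := σ) (κ := κ) (ν := ν) ha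
  have hprob := isProbabilityMeasure_channelLaw (σ := σ) (κ := κ) (ν := ν') ha
  have hlaw : channelLaw σ κ a ν' = (channelLaw σ κ a ν).withDensity fun o =>
      ENNReal.ofReal (1 + ∫ s, X s ∂(posterior σ a ν o)) :=
    hν' ▸ channelLaw_withDensity_one_add hσ ha hX (.of_bound hX.aestronglyMeasurable 1
      (ae_of_all _ hX1)) fun s => by linarith [(abs_le.1 (hX1 s)).1]
  rw [hlaw] at hprob ⊢
  have hmean := memLp_two_integral_posterior (σ := σ) (κ := κ) (ν := ν) ha hX hX1
  have hL0 (o : U × Euc ℓ) : 0 ≤ 1 + ∫ s, X s ∂(posterior σ a ν o) := by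
    linarith [(abs_le.1 (abs_integral_posterior_le (σ := σ) (ν := ν) ha hX1 o)).1]
  have hLm : Measurable fun o => 1 + ∫ s, X s ∂(posterior σ a ν o) :=
    measurable_const.add (measurable_integral_posterior ha hX)
  have hL := (memLp_const (1 : ℝ)).add hmean
  have hL1 : ∫ o, (1 + ∫ s, X s ∂(posterior σ a ν o)) ∂(channelLaw σ κ a ν) = 1 := by
    rw [integral_eq_lintegral_of_nonneg_ae (ae_of_all _ hL0) hLm.aestronglyMeasurable,
      ← setLIntegral_univ, ← withDensity_apply _ .univ, measure_univ, ENNReal.toReal_one]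
  have hL2 := integral_sub_one_sq hL hL1
  simp only [Pi.add_apply, add_sub_cancel_left] at hL2
  rw [channelChiSq, hL2, add_sub_cancel]
  exact abs_integral_prod_pi_sub_le ρ hLm hL0 hL hL1 hF hb

end TwoPriors

section HardInstance

variable {d ℓ : ℕ} {B P b σ : ℝ} {p : unitInterval}

/-- The cube of side `2b`. -/
def cube (d : ℕ) (b : ℝ) : Set (Euc d) := {x | ∀ i, |x i| ≤ b}

lemma convex_cube (b : ℝ) : Convex ℝ (cube d b) := by
  intro x hx y hy r s hr hs hrs i
  calc |r * x i + s * y i| ≤ |r * x i| + |s * y i| := abs_add_le _ _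
    _ = r * |x i| + s * |y i| := by rw [abs_mul, abs_mul, abs_of_nonneg hr, abs_of_nonneg hs]
    _ ≤ r * b + s * b := by
        gcongr
        exacts [hx i, hy i]
    _ = b := by rw [← add_mul, hrs, one_mul]

lemma cube_mem_domains (hb : 0 ≤ b) : cube d b ∈ domains d (2 * b * √d) := by
  refine ⟨⟨0, fun i => by simpa using hb⟩, convex_cube b, fun x hx y hy => ?_⟩
  refine le_of_sq_le_sq ?_ (by positivity)
  rw [EuclideanSpace.real_norm_sq_eq, mul_pow, Real.sq_sqrt (by positivity)]
  calc ∑ i, (x - y) i ^ 2 ≤ ∑ _i : Fin d, (2 * b) ^ 2 := by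
        refine Finset.sum_le_sum fun i _ => sq_le_sq' ?_ ?_ <;> rw [PiLp.sub_apply] <;>
          linarith [abs_le.1 (hx i), abs_le.1 (hy i)]
    _ = (2 * b) ^ 2 * d := by simp [mul_comm]

/-- The law of the subgradient estimate `gradVec B s` for a random sign vector `s` which is biased
towards `v`. -/
def gradLaw (B : ℝ) (p : unitInterval) (v : Fin d → Bool) : Measure (Euc d) :=
  (signVecLaw p v).map (gradVec B)

lemma measurable_gradVec (B : ℝ) : Measurable (gradVec B : (Fin d → Bool) → Euc d) :=
  measurable_of_finite _

instance (B : ℝ) (p : unitInterval) (v : Fin d → Bool) : IsProbabilityMeasure (gradLaw B p v) :=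
  Measure.isProbabilityMeasure_map (measurable_gradVec B).aemeasurable

lemma integral_gradLaw (B : ℝ) (p : unitInterval) (v : Fin d → Bool) :
    ∫ g, g ∂(gradLaw B p v) = (2 * (p : ℝ) - 1) • gradVec B v := by
  rw [gradLaw, integral_map (measurable_gradVec B).aemeasurable (by fun_prop), integral_gradVec]

lemma lintegral_enorm_sq_gradLaw (hd : 0 < d) (B : ℝ) (p : unitInterval) (v : Fin d → Bool) :
    ∫⁻ g, ‖g‖ₑ ^ 2 ∂(gradLaw B p v) = ENNReal.ofReal (B ^ 2) := by
  have hnorm (s : Fin d → Bool) : ‖gradVec B s‖ₑ ^ 2 = ENNReal.ofReal (B ^ 2) := by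
    rw [← ofReal_norm, ← ENNReal.ofReal_pow (norm_nonneg _), norm_sq_gradVec hd]
  rw [gradLaw, lintegral_map (by fun_prop) (measurable_gradVec B)]
  simp [hnorm]

/-- The hard instance with sign vector `v`: a linear function with a constant oracle, which returns
`gradVec B s` for a random sign vector `s` biased towards `v`. -/
def hardInstance (hd : 0 < d) (B b : ℝ) (p : unitInterval) (v : Fin d → Bool) :
    Instance (cube d b) B where
  f x := inner ℝ ((2 * (p : ℝ) - 1) • gradVec B v) x
  convex := ⟨convex_cube b, fun x _ y _ r s _ _ _ => by
    simp only [inner_add_right, inner_smul_right, smul_eq_mul, le_refl]⟩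
  O := Kernel.const _ (gradLaw B p v)
  markov := inferInstance
  unbiased x y _ := by rw [Kernel.const_apply, integral_gradLaw, ← inner_add_right, add_sub_cancel]
  meanSquare _ := (lintegral_enorm_sq_gradLaw hd B p v).le

/-- The channel input produced by the code `c` from `gradVec B s` and the public randomness. -/
def signInput (c : Code d ℓ B P) (q : (Fin d → Bool) × c.U) : Euc ℓ := c.enc (gradVec B q.1) q.2

variable (c : Code d ℓ B P)

lemma measurable_signInput : Measurable (signInput c) :=
  c.measurable_enc.comp (((measurable_gradVec B).comp measurable_fst).prodMk measurable_snd)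

lemma observe_hardInstance (hd : 0 < d) (v : Fin d → Bool) (x : cube d b) :
    observe c σ (hardInstance hd B b p v).O x =
      channelLaw σ c.lawU (signInput c) (signVecLaw p v) := by
  rw [observe_apply]
  exact channelLaw_map c.measurable_enc (measurable_gradVec B) (signVecLaw p v)

lemma lintegral_enorm_sq_signInput_le (hd : 0 < d) (v : Fin d → Bool) :
    ∫⁻ q, ‖signInput c q‖ₑ ^ 2 ∂((signVecLaw p v).prod c.lawU) ≤ ENNReal.ofReal (ℓ * P) := by
  have hsig := measurable_signInput c
  have henc : Measurable fun q : Euc d × c.U => ‖c.enc q.1 q.2‖ₑ ^ 2 :=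
    c.measurable_enc.enorm.pow_const 2
  have hpower := c.power (gradLaw B p v) inferInstance (lintegral_enorm_sq_gradLaw hd B p v).le
  rw [gradLaw, lintegral_map henc.lintegral_prod_right' (measurable_gradVec B)] at hpower
  rwa [lintegral_prod _ (by fun_prop)]

lemma iIndepFun_flipExcess (v : Fin d → Bool) :
    iIndepFun (fun i s => flipExcess p (v i) (s i)) (signVecLaw p v) :=
  iIndepFun_pi fun i => (measurable_of_finite (flipExcess p (v i))).aemeasurable

lemma sum_channelChiSq_hardInstance_le (hd : 0 < d) (hP : 0 ≤ P) (hσ : σ ≠ 0)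
    (hp0 : 1 / 2 ≤ (p : ℝ)) (hp1 : (p : ℝ) ≤ 3 / 4) (v : Fin d → Bool) :
    ∑ i, channelChiSq σ c.lawU (signInput c) (signVecLaw p v) (fun s => flipExcess p (v i) (s i)) ≤
      (4 * (2 * p - 1)) ^ 2 * (ℓ * (P / σ ^ 2)) := by
  have hsig := measurable_signInput c
  have hpower := lintegral_enorm_sq_signInput_le (p := p) c hd v
  refine (sum_channelChiSq_le hσ hsig (memLp_two_of_lintegral_enorm_sq_le
    hsig.aestronglyMeasurable hpower) (fun i => measurable_of_finite _)
    (fun i s => abs_flipExcess_le hp0 hp1 (v i) (s i)) (iIndepFun_flipExcess v)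
    (hasSubgaussianMGF_flipExcess hp0 hp1 v)).trans ?_
  rw [← mul_div_assoc (ℓ : ℝ), ← mul_div_assoc, NNReal.coe_pow, coe_nnnorm,
    Real.norm_eq_abs, sq_abs]
  gcongr
  exact integral_norm_sq_le_of_lintegral_enorm_sq_le hsig.aestronglyMeasurable (by positivity)
    hpower

end HardInstance

section LowerBound

variable {d ℓ T : ℕ} {B P b σ : ℝ} {p : unitInterval} {c : Code d ℓ B P}
  (π : Algorithm (cube d b) c T)

lemma inner_smul_gradVec (a B : ℝ) (v : Fin d → Bool) (x : Euc d) :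
    inner ℝ (a • gradVec B v) x = a * B / √d * ∑ i, sgn (v i) * x i := by
  rw [inner_smul_left, PiLp.inner_apply, Finset.mul_sum, Finset.mul_sum]
  refine Finset.sum_congr rfl fun i _ => ?_
  simp only [gradVec, RCLike.inner_apply, conj_trivial]
  ring

/-- The mean of a coordinate of the output on the hard instance with sign vector `v`, signed and
shifted so as to be the contribution of that coordinate to the error, up to a constant factor. -/
def coordError (σ : ℝ) (π : Algorithm (cube d b) c T) (hd : 0 < d) (p : unitInterval)
    (v : Fin d → Bool) (i : Fin d) : ℝ :=
  sgn (v i) * ∫ h, (π.output h : Euc d) i ∂(transcript σ π (hardInstance hd B b p v).O T) + b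

lemma measurable_output_apply (i : Fin d) : Measurable fun h => (π.output h : Euc d) i := by
  have := π.measurable_output
  fun_prop

lemma coordError_nonneg (hd : 0 < d) (v : Fin d → Bool) (i : Fin d) :
    0 ≤ coordError σ π hd p v i := by
  have hmean := norm_integral_le_of_norm_le_const
    (μ := transcript σ π (hardInstance hd B b p v).O T)
    (ae_of_all _ fun h => show ‖(π.output h : Euc d) i‖ ≤ b from (π.output h).2 i)
  rw [probReal_univ, mul_one, Real.norm_eq_abs, ← abs_sgn_mul (v i)] at hmean
  rw [coordError]
  linarith [(abs_le.1 hmean).1]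

lemma iInf_hardInstance_le (hd : 0 < d) (hb : 0 ≤ b) (v : Fin d → Bool) :
    ⨅ x : cube d b, (hardInstance hd B b p v).f x ≤ (2 * p - 1) * B / √d * ∑ _i : Fin d, -b := by
  have hdom := cube_mem_domains (d := d) hb
  let x₀ : cube d b := ⟨WithLp.toLp 2 fun i => -(b * sgn (v i)), fun i => by
    rw [abs_neg, abs_mul, abs_sgn, mul_one, abs_of_nonneg hb]⟩
  refine (ciInf_le ⟨(hardInstance hd B b p v).f x₀ - |B| * (2 * b * √d), ?_⟩ x₀).trans_eq ?_
  · rintro - ⟨x, rfl⟩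
    linarith [(abs_le.1 ((hardInstance hd B b p v).abs_sub_le_of_mem_domains hdom x x₀)).1]
  · refine (inner_smul_gradVec _ B v x₀).trans ?_
    congr 1
    refine Finset.sum_congr rfl fun i _ => ?_
    linear_combination (-b) * sgn_mul_self (v i)

lemma integral_hardInstance (hd : 0 < d) (v : Fin d → Bool) :
    ∫ h, (hardInstance hd B b p v).f (π.output h)
        ∂(transcript σ π (hardInstance hd B b p v).O T) =
      (2 * p - 1) * B / √d * ∑ i, sgn (v i) * ∫ h, (π.output h : Euc d) i
        ∂(transcript σ π (hardInstance hd B b p v).O T) := by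
  have hint (i : Fin d) : Integrable (fun h => sgn (v i) * (π.output h : Euc d) i)
      (transcript σ π (hardInstance hd B b p v).O T) :=
    (Integrable.of_bound (measurable_output_apply π i).aestronglyMeasurable b
      (ae_of_all _ fun h => (π.output h).2 i)).const_mul _
  simp only [hardInstance, inner_smul_gradVec] at hint ⊢
  rw [integral_const_mul, integral_finsetSum _ fun i _ => hint i]
  simp only [integral_const_mul]

lemma le_convError_hardInstance (hd : 0 < d) (hb : 0 ≤ b) (v : Fin d → Bool) :
    (2 * p - 1) * B / √d * ∑ i, coordError σ π hd p v i ≤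
      convError σ π (hardInstance hd B b p v) := by
  rw [convError, integral_hardInstance]
  have hinf := iInf_hardInstance_le (B := B) (p := p) hd hb v
  rw [Finset.sum_neg_distrib, mul_neg] at hinf
  simp only [coordError, Finset.sum_add_distrib, mul_add]
  linarith

lemma sqrt_one_add_pow_sub_one_le {x : ℝ} (hx : 0 ≤ x) {n : ℕ} (hn : n * x ≤ 1) :
    √((1 + x) ^ n - 1) ≤ 1 + n * x := by
  have hnx : 0 ≤ n * x := by positivity
  have hpow : (1 + x) ^ n ≤ Real.exp (n * x) := by
    rw [Real.exp_nat_mul, add_comm]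
    gcongr
    exact Real.add_one_le_exp x
  have hexp := (abs_le.1 (Real.abs_exp_sub_one_sub_id_le (abs_le.2 ⟨by linarith, hn⟩))).2
  exact Real.sqrt_le_iff.2 ⟨by linarith, by nlinarith⟩

variable (hd : 0 < d) (hσ : σ ≠ 0) (hp0 : 1 / 2 ≤ (p : ℝ)) (hp1 : (p : ℝ) ≤ 5 / 8)
include hd hσ hp0 hp1

lemma abs_integral_output_flipAt_sub_le (v : Fin d → Bool) (i : Fin d) :
    |∫ h, (π.output h : Euc d) i ∂(transcript σ π (hardInstance hd B b p (flipAt i v)).O T) -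
        ∫ h, (π.output h : Euc d) i ∂(transcript σ π (hardInstance hd B b p v).O T)| ≤
      b * √((1 + channelChiSq σ c.lawU (signInput c) (signVecLaw p v)
        fun s => flipExcess p (v i) (s i)) ^ T - 1) := by
  have hprob (v : Fin d → Bool) := isProbabilityMeasure_channelLaw (σ := σ) (κ := c.lawU)
    (ν := signVecLaw p v) (measurable_signInput c)
  rw [transcript_eq_prod_pi π _ (observe_hardInstance c hd v),
    transcript_eq_prod_pi π _ (observe_hardInstance c hd (flipAt i v))]
  exact abs_integral_prod_pi_channelLaw_sub_le hσ (measurable_signInput c)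
    (measurable_of_finite _)
    (fun s => (abs_flipExcess_le hp0 (by linarith) (v i) (s i)).trans (by linarith))
    (signVecLaw_flipAt (by linarith) (by linarith) v i) π.lawW (measurable_output_apply π i)
    fun h => (π.output h).2 i

lemma le_coordError_add_coordError_flipAt (hb : 0 ≤ b) (v : Fin d → Bool) (i : Fin d) :
    b * (1 - T * channelChiSq σ c.lawU (signInput c) (signVecLaw p v)
        fun s => flipExcess p (v i) (s i)) ≤
      coordError σ π hd p v i + coordError σ π hd p (flipAt i v) i := by
  have hbound := abs_integral_output_flipAt_sub_le π hd hσ hp0 hp1 v i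
  have hχ := channelChiSq_nonneg σ c.lawU (signInput c) (signVecLaw p v)
    fun s => flipExcess p (v i) (s i)
  set χ := channelChiSq σ c.lawU (signInput c) (signVecLaw p v) fun s => flipExcess p (v i) (s i)
  rcases le_total (T * χ) 1 with hT | hT
  · replace hbound := hbound.trans
      (mul_le_mul_of_nonneg_left (sqrt_one_add_pow_sub_one_le hχ hT) hb)
    rw [← abs_sgn_mul (v i), mul_sub] at hbound
    rw [coordError, coordError, flipAt_apply_self, sgn_not]
    linarith [(abs_le.1 hbound).2]
  · have hneg : b * (1 - T * χ) ≤ 0 := mul_nonpos_of_nonneg_of_nonpos hb (by linarith)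
    linarith [coordError_nonneg (σ := σ) (p := p) π hd v i,
      coordError_nonneg (σ := σ) (p := p) π hd (flipAt i v) i]

lemma le_sum_coordError_add_coordError_flipAt (hP : 0 ≤ P) (hb : 0 ≤ b)
    (hcap : (4 * (2 * (p : ℝ) - 1)) ^ 2 * (T * (ℓ * (P / σ ^ 2))) ≤ d / 4) (v : Fin d → Bool) :
    b * (3 / 4 * d) ≤ ∑ i, (coordError σ π hd p v i + coordError σ π hd p (flipAt i v) i) := by
  refine le_trans ?_ (Finset.sum_le_sum fun i _ =>
    le_coordError_add_coordError_flipAt π hd hσ hp0 hp1 hb v i)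
  have hsum := mul_le_mul_of_nonneg_left
    (sum_channelChiSq_hardInstance_le c hd hP hσ hp0 (by linarith) v) (Nat.cast_nonneg (α := ℝ) T)
  rw [← Finset.mul_sum, Finset.sum_sub_distrib, ← Finset.mul_sum, Finset.sum_const,
    Finset.card_univ, Fintype.card_fin, nsmul_one]
  exact mul_le_mul_of_nonneg_left (by linarith) hb

lemma exists_le_sum_coordError (hP : 0 ≤ P) (hb : 0 ≤ b)
    (hcap : (4 * (2 * (p : ℝ) - 1)) ^ 2 * (T * (ℓ * (P / σ ^ 2))) ≤ d / 4) :
    ∃ v, b * (3 / 8 * d) ≤ ∑ i, coordError σ π hd p v i := by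
  have hflip : ∑ v, ∑ i, coordError σ π hd p (flipAt i v) i =
      ∑ v, ∑ i, coordError σ π hd p v i := by
    rw [Finset.sum_comm, Finset.sum_comm (f := fun v i => coordError σ π hd p v i)]
    exact Finset.sum_congr rfl fun i _ => Equiv.sum_comp
      (Function.Involutive.toPerm (flipAt i) (flipAt_flipAt i)) fun v => coordError σ π hd p v i
  have hpair := Finset.sum_le_sum fun v (_ : v ∈ Finset.univ) =>
    le_sum_coordError_add_coordError_flipAt π hd hσ hp0 hp1 hP hb hcap v
  simp only [Finset.sum_add_distrib] at hpair
  rw [hflip, ← two_mul, Finset.mul_sum] at hpair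
  obtain ⟨v, -, hv⟩ := Finset.exists_le_of_sum_le Finset.univ_nonempty hpair
  exact ⟨v, by linarith⟩

lemma exists_le_convError (hP : 0 ≤ P) (hB : 0 ≤ B) (hb : 0 ≤ b)
    (hcap : (4 * (2 * (p : ℝ) - 1)) ^ 2 * (T * (ℓ * (P / σ ^ 2))) ≤ d / 4) :
    ∃ I : Instance (cube d b) B, 3 / 8 * (2 * (p : ℝ) - 1) * B * √d * b ≤ convError σ π I := by
  obtain ⟨v, hv⟩ := exists_le_sum_coordError π hd hσ hp0 hp1 hP hb hcap
  refine ⟨hardInstance hd B b p v, le_trans ?_ (le_convError_hardInstance π hd hb v)⟩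
  have hδ : 0 ≤ 2 * (p : ℝ) - 1 := by linarith
  have hd' : (0 : ℝ) < d := by exact_mod_cast hd
  calc 3 / 8 * (2 * (p : ℝ) - 1) * B * √d * b
      = (2 * p - 1) * B / √d * (b * (3 / 8 * d)) := by
        field_simp
        rw [Real.sq_sqrt hd'.le]
        ring
    _ ≤ (2 * p - 1) * B / √d * ∑ i, coordError σ π hd p v i := by gcongr

end LowerBound

section AllCodes

variable {d N : ℕ} {B P D σ : ℝ}

lemma le_worstError_of_le {ℓ T : ℕ} {c : Code d ℓ B P} {r : ℝ} (hd : 0 < d) (hB : 0 ≤ B)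
    (hP : 0 ≤ P) (hD : 0 ≤ D) (hσ : σ ≠ 0) (hr0 : 0 ≤ r) (hr1 : r ≤ 1)
    (hcap : r ^ 2 * (T * (ℓ * (P / σ ^ 2))) ≤ d) (π : Algorithm (cube d (D / (2 * √d))) c T) :
    ((1 / 64 * (D * B * r) : ℝ) : EReal) ≤ worstError σ π := by
  have : (0 : ℝ) < d := by exact_mod_cast hd
  let p : unitInterval := ⟨(1 + r / 8) / 2, by constructor <;> linarith⟩
  have hp : 2 * (p : ℝ) - 1 = r / 8 := by simp only [p]; ring
  obtain ⟨I, hI⟩ := exists_le_convError (σ := σ) (p := p) π hd hσ (by linarith) (by linarith) hP hB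
    (by positivity) (by rw [hp]; linarith)
  refine le_iSup_of_le I (EReal.coe_le_coe_iff.2 (le_trans ?_ hI))
  rw [hp]
  calc 1 / 64 * (D * B * r) ≤ 3 / 128 * (D * B * r) := by
        gcongr ?_ * _
        norm_num
    _ = 3 / 8 * (r / 8) * B * √d * (D / (2 * √d)) := by
        field_simp
        ring

lemma le_minimaxError_allCodes (hd : 0 < d) (hD : 0 ≤ D) (hB : 0 ≤ B) (hσ : σ ≠ 0)
    (hSNR : P / σ ^ 2 ∈ Set.Ioo (0 : ℝ) 1) (hN : d / Real.logb 2 (1 + P / σ ^ 2) ≤ N) :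
    ((1 / 64 * (D * B / √N * √(d / Real.logb 2 (1 + P / σ ^ 2))) : ℝ) : EReal) ≤
      minimaxError (allCodes d B P) D σ N := by
  obtain ⟨hs, hs1⟩ := hSNR
  have hP : 0 < P := (div_pos_iff_of_pos_right (by positivity)).1 hs
  have hsC := le_logb_two_one_add hs.le hs1.le
  set C := Real.logb 2 (1 + P / σ ^ 2)
  have hC : 0 < C := hs.trans_le hsC
  have hd' : (0 : ℝ) < d := by exact_mod_cast hd
  have hN' : (0 : ℝ) < N := (div_pos hd' hC).trans_le hN
  have hdom : cube d (D / (2 * √d)) ∈ domains d D := by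
    have hcube := cube_mem_domains (d := d) (b := D / (2 * √d)) (by positivity)
    have hside : 2 * (D / (2 * √d)) * √d = D := by field_simp
    rwa [hside] at hcube
  refine le_trans ?_ (le_iSup₂_of_le _ hdom le_rfl)
  refine le_iInf₂ fun ℓ _ => le_iInf₂ fun T hT => le_iInf₂ fun c _ => le_iInf fun π => ?_
  have hcap : √(d / C / N) ^ 2 * (T * (ℓ * (P / σ ^ 2))) ≤ d := by
    rw [Real.sq_sqrt (by positivity)]
    calc d / C / N * (T * (ℓ * (P / σ ^ 2))) = d / C / N * (ℓ * T * (P / σ ^ 2)) := by ring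
      _ ≤ d / C / N * (N * C) := by
          gcongr
          exact_mod_cast hT
      _ = d := by field_simp
  have hworst := le_worstError_of_le hd hB hP.le hD hσ (Real.sqrt_nonneg (d / C / N))
    (Real.sqrt_le_one.2 ((div_le_one hN').2 hN)) hcap π
  rwa [Real.sqrt_div' _ hN'.le, ← mul_div_assoc, mul_div_right_comm] at hworst

end AllCodes

end

end OverTheAir

theorem corollary1 :
    ∃ c₁ c₂ : ℝ, 0 < c₁ ∧ 0 < c₂ ∧
      ∀ (d N : ℕ) (D B P σ SNR : ℝ), 1 ≤ d → 0 < D → 0 < B → 0 < P → 0 < σ →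
        SNR = P / σ ^ 2 → SNR ∈ Set.Ioo (0 : ℝ) 1 →
        (d : ℝ) / Real.logb 2 (1 + SNR) ≤ (N : ℝ) →
        -- two-sided bound on the min-max error of analog codes
        ((c₁ * (D * B / √N * √(d / Real.logb 2 (1 + SNR))) : ℝ) : EReal) ≤
            OverTheAir.minimaxError (OverTheAir.analogCodes d B P) D σ N ∧
        OverTheAir.minimaxError (OverTheAir.analogCodes d B P) D σ N ≤
          ((c₂ * (D * B / √N * √(d / Real.logb 2 (1 + SNR))) : ℝ) : EReal) ∧
        -- optimality: no code does better in order, and scaled transmission attains the order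
        ((c₁ * (D * B / √N * √(d / Real.logb 2 (1 + SNR))) : ℝ) : EReal) ≤
            OverTheAir.minimaxError (OverTheAir.allCodes d B P) D σ N ∧
        OverTheAir.minimaxError (OverTheAir.scaledTransmission d B P) D σ N ≤
          ((c₂ * (D * B / √N * √(d / Real.logb 2 (1 + SNR))) : ℝ) : EReal) := by
  refine ⟨1 / 64, 5, by norm_num, by norm_num, ?_⟩
  rintro d N D B P σ _ hd hD hB - hσ rfl hSNR hN
  have hlower := OverTheAir.le_minimaxError_allCodes hd hD.le hB.le hσ.ne' hSNR hN
  have hupper := OverTheAir.minimaxError_scaledTransmission_le_logb hd hD hB hσ hSNR hN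
  have hanalog := OverTheAir.minimaxError_anti
    (OverTheAir.scaledTransmission_subset_analogCodes d B P) D σ N
  have hall := OverTheAir.minimaxError_anti (C := OverTheAir.analogCodes d B P)
    (fun _ => Set.subset_univ _) D σ N
  exact ⟨hlower.trans hall, hanalog.trans hupper, hlower, hupper⟩
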